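/- **Theorem.** Let $\mathbf x\mapsto s(t)A(t)\mathbf x+\mathbf d(t)$, $t\in I$ ($I$ an open interval containing $0$), be a $C^1$ one-parameter equiform motion of Euclidean space $\mathbf E^7$, with $s(t)>0$, $A(t)\in SO(7)$ and $s(0)=1$, $A(0)=\mathbf I$, $\mathbf d(0)=0$. Put $s'=\dot s(0)$, $\Omega=\dot A(0)$ and $\mathbf d'=\dot{\mathbf d}(0)=(b_1',\dots,b_7')$, and let $\omega_1,\dots,\omega_{21}$ be the entries of the skew-symmetric matrix $\Omega$ above the diagonal, read row by row (so $\omega_1,\dots,\omega_6$ in the first row, $\omega_7,\dots,\omega_{11}$ in the second, $\omega_{12},\dots,\omega_{15}$ in the third, and so on). Let $\mathbf x(\theta,\phi)=(\cos\theta\cos\phi,\sin\theta\cos\phi,\sin\phi,0,0,0,0)$ be the unit sphere of the coordinate space $[x_1x_2x_3]$, and consider the kinematic 3-surface, represented up to first order in $t$, $$\mathbf X(t,\theta,\phi)=\big[\mathbf I+t\,(s'\mathbf I+\Omega)\big]\mathbf x(\theta,\phi)+t\,\mathbf d'.$$ Assume that it is foliated by spheres, i.e. that for each $t\in I$ the image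 of the unit sphere (in general an ellipsoid with centre $t\,\mathbf d'$) lies at a constant distance from $t\,\mathbf d'$, and that there is no translation in the 3-space of the starting sphere: $b_1'=b_2'=b_3'=0$. Let $g_{ij}$ be the induced metric in the coordinates $(x_1,x_2,x_3)=(t,\theta,\phi)$, $\Gamma_{ij}^l$ its Christoffel symbols, and let $$\mathbf K=-g^{ij}\Big[\frac{\partial\Gamma_{ij}^l}{\partial x_l}-\frac{\partial\Gamma_{il}^l}{\partial x_j}+\Gamma_{ij}^l\Gamma_{lm}^m-\Gamma_{il}^m\Gamma_{jm}^l\Big]$$ be its scalar curvature in the sign convention in which round spheres have negative scalar curvature. Suppose that $\mathbf K(0,\theta,\phi)=-\tfrac32$ for all $(\theta,\phi)\in[0,2\pi]\times[0,\pi]$ at which the parametrization is regular, i.e. $\det(g_{ij})(0,\theta,\phi)\ne0$. Then $\omega_1=\omega_2=\omega_7=0$, and at least one of the following two systems holds: $$s'^2+3\sum_{i=3}^6\omega_i^2=\sum_{i=4}^7b_i'^2,$$ $$4\Big[s'^2+2\sum_{i=4}^7b_i'^2\Big]^2=9\Big[4\Big(\sum_{i=4}^7b_i'\omega_{i+8}\Big)^2+4\Big(\sum_{i=4}^7b_i'\omega_{i-1}\Big)^2+4\Big(\sum_{i=4}^7b_i'\omega_{i+4}\Big)^2\Big];$$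 or $$\sum_{i=4}^7b_i'\omega_{i-1}=\sum_{i=4}^7b_i'\omega_{i+4}=\sum_{i=4}^7b_i'\omega_{i+8}=0,\qquad 3s'^2+7\sum_{i=3}^6\omega_i^2=\sum_{i=4}^7b_i'^2.$$ -/

import Mathlib

/-!  Equiform motions of Euclidean 7-space, the three-dimensional surfaces swept out to first order
by a unit 2-sphere, and their scalar curvature. -/

noncomputable section

/-- A one-parameter equiform motion `x ↦ s(t) A(t) x + d(t)` of Euclidean 7-space, of class `C¹`
on an open time interval `I` around `0`, which is the identity at the zero position `t = 0`. -/
structure EquiformMotion where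
  /-- the time interval -/
  I : Set ℝ
  /-- the scaling factor -/
  s : ℝ → ℝ
  /-- the rotational part -/
  A : ℝ → Matrix (Fin 7) (Fin 7) ℝ
  /-- the position of the origin of the moving space -/
  d : ℝ → Fin 7 → ℝ
  isOpen_I : IsOpen I
  ordConnected_I : I.OrdConnected
  zero_mem_I : (0 : ℝ) ∈ I
  s_pos : ∀ t ∈ I, 0 < s t
  A_mem : ∀ t ∈ I, A t ∈ Matrix.specialOrthogonalGroup (Fin 7) ℝ
  contDiffOn_s : ContDiffOn ℝ 1 s I
  contDiffOn_A : ∀ i j, ContDiffOn ℝ 1 (fun t => A t i j) I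
  contDiffOn_d : ∀ i, ContDiffOn ℝ 1 (fun t => d t i) I
  s_zero : s 0 = 1
  A_zero : A 0 = 1
  d_zero : d 0 = 0

namespace EquiformMotion

/-- `s' = ds/dt (0)`. -/
def s' (M : EquiformMotion) : ℝ := deriv M.s 0

/-- `Ω = dA/dt (0)`. -/
def Omega (M : EquiformMotion) : Matrix (Fin 7) (Fin 7) ℝ :=
  Matrix.of fun i j => deriv (fun t => M.A t i j) 0

/-- `d' = dd/dt (0)`. -/
def d' (M : EquiformMotion) : Fin 7 → ℝ := fun i => deriv (fun t => M.d t i) 0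

/-- The entries `ω₁, …, ω₂₁` of the skew-symmetric matrix `Ω` above the diagonal, read row by row
(indices outside `1, …, 21` are not used). -/
def ω (M : EquiformMotion) : ℕ → ℝ
  | 1 => M.Omega 0 1
  | 2 => M.Omega 0 2
  | 3 => M.Omega 0 3
  | 4 => M.Omega 0 4
  | 5 => M.Omega 0 5
  | 6 => M.Omega 0 6
  | 7 => M.Omega 1 2
  | 8 => M.Omega 1 3
  | 9 => M.Omega 1 4
  | 10 => M.Omega 1 5
  | 11 => M.Omega 1 6
  | 12 => M.Omega 2 3
  | 13 => M.Omega 2 4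
  | 14 => M.Omega 2 5
  | 15 => M.Omega 2 6
  | 16 => M.Omega 3 4
  | 17 => M.Omega 3 5
  | 18 => M.Omega 3 6
  | 19 => M.Omega 4 5
  | 20 => M.Omega 4 6
  | 21 => M.Omega 5 6
  | _ => 0

/-- The components `b'₁, …, b'₇` of `d'` (indices outside `1, …, 7` are not used). -/
def b' (M : EquiformMotion) : ℕ → ℝ
  | 1 => M.d' 0
  | 2 => M.d' 1
  | 3 => M.d' 2
  | 4 => M.d' 3
  | 5 => M.d' 4
  | 6 => M.d' 5
  | 7 => M.d' 6
  | _ => 0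

end EquiformMotion

/-- The unit 2-sphere of the coordinate 3-space `[x₁ x₂ x₃]`, in spherical coordinates. -/
def unitSpherePoint (θ φ : ℝ) : Fin 7 → ℝ :=
  ![Real.cos θ * Real.cos φ, Real.sin θ * Real.cos φ, Real.sin φ, 0, 0, 0, 0]

namespace EquiformMotion

/-- The kinematic 3-surface generated by the unit sphere, represented up to first order in `t`:
`X(t, θ, φ) = [1 + t (s' 1 + Ω)] x(θ, φ) + t d'`; the coordinates are `u = (t, θ, φ)`. -/
def surface (M : EquiformMotion) (u : Fin 3 → ℝ) : Fin 7 → ℝ :=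
  (1 + u 0 • (M.s' • (1 : Matrix (Fin 7) (Fin 7) ℝ) + M.Omega)).mulVec
    (unitSpherePoint (u 1) (u 2)) + u 0 • M.d'

/-- The surface is foliated by spheres: for each `t`, the image of the unit sphere under the affine
map `x ↦ [1 + t (s' 1 + Ω)] x + t d'` (in general an ellipsoid with centre `t d'`) lies at a
constant Euclidean distance from its centre. -/
def FoliatedBySpheres (M : EquiformMotion) : Prop :=
  ∀ t ∈ M.I, ∃ r : ℝ, ∀ θ φ : ℝ,
    (M.surface ![t, θ, φ] - t • M.d') ⬝ᵥ (M.surface ![t, θ, φ] - t • M.d') = r ^ 2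

end EquiformMotion

/-- Partial derivative with respect to the `i`-th coordinate. -/
def partialDeriv {E : Type*} [NormedAddCommGroup E] [NormedSpace ℝ E]
    (i : Fin 3) (f : (Fin 3 → ℝ) → E) (u : Fin 3 → ℝ) : E :=
  deriv (fun h : ℝ => f (Function.update u i h)) (u i)

section Curvature

/-- First fundamental form `g_{ij} = X_i · X_j` of a parametrized 3-surface in Euclidean 7-space. -/
def firstFundamentalForm (X : (Fin 3 → ℝ) → Fin 7 → ℝ) (u : Fin 3 → ℝ) :
    Matrix (Fin 3) (Fin 3) ℝ :=
  Matrix.of fun i j => partialDeriv i X u ⬝ᵥ partialDeriv j X u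

/-- Christoffel symbols of the second kind `Γ^l_{ij}` of a metric `g` in coordinates. -/
def christoffel (g : (Fin 3 → ℝ) → Matrix (Fin 3) (Fin 3) ℝ) (l i j : Fin 3)
    (u : Fin 3 → ℝ) : ℝ :=
  (1 / 2) * ∑ m, (g u)⁻¹ l m *
    (partialDeriv j (fun v => g v i m) u + partialDeriv i (fun v => g v j m) u
      - partialDeriv m (fun v => g v i j) u)

/-- The Ricci tensor in the sign convention for which round spheres have positive curvature. -/
def ricci (g : (Fin 3 → ℝ) → Matrix (Fin 3) (Fin 3) ℝ) (i j : Fin 3) (u : Fin 3 → ℝ) : ℝ :=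
  ∑ l, partialDeriv l (christoffel g l i j) u
    - ∑ l, partialDeriv j (christoffel g l i l) u
    + ∑ l, ∑ m, (christoffel g l i j u * christoffel g m l m u
      - christoffel g m i l u * christoffel g l j m u)

/-- The scalar curvature `R = g^{ij} R_{ij}`, positive for round spheres. -/
def scalarCurvature (g : (Fin 3 → ℝ) → Matrix (Fin 3) (Fin 3) ℝ) (u : Fin 3 → ℝ) : ℝ :=
  ∑ i, ∑ j, (g u)⁻¹ i j * ricci g i j u

end Curvature

namespace EquiformMotion

/-- The metric induced on the kinematic 3-surface. -/
def metric (M : EquiformMotion) : (Fin 3 → ℝ) → Matrix (Fin 3) (Fin 3) ℝ :=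
  firstFundamentalForm M.surface

/-- The scalar curvature `K(t, θ, φ)` of the kinematic 3-surface in the sign convention
`K = -R` (older texts), in which round spheres have negative scalar curvature. -/
def K (M : EquiformMotion) (t θ φ : ℝ) : ℝ :=
  -scalarCurvature M.metric ![t, θ, φ]

/-- The parametrized kinematic 3-surface is regular at `(t, θ, φ)`: `det (g_{ij}) ≠ 0`. -/
def RegularAt (M : EquiformMotion) (t θ φ : ℝ) : Prop :=
  (M.metric ![t, θ, φ]).det ≠ 0

end EquiformMotion

end

-- Let x be a point of the unit sphere. Since Ω is skew, x · Ωx = 0, so the squared distance from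
-- the centre is (1 + ts')² + t²|Ωx|². Its constancy at a single t ≠ 0 makes Ω conformal on the
-- 3-space: Ωy · Ωz = c (y · z) (`exists_gram`). As d' is orthogonal to the 3-space, the induced
-- metric then depends only on s = s', c, the rotation vector a of the block of Ω inside the
-- 3-space, the projection β of Ωd' to the 3-space, and C = s² + c + |d'|² (`metric_eq_kinMetric`).
--
-- At t = 0 one has det g = cos²φ · E with E = C - 2 β·x - |a_tan|², where a_tan is the part of a
-- tangent to the sphere. With R = -K, the product E²R is a polynomial in the components of a and β
-- in the spherical frame (`scalarCurvature_kinMetric_zero`). Let Q be the polynomial expression of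
-- E²(R - 3/2). The hypothesis gives cos φ · E · Q = 0 on an open box, hence by analyticity E ≡ 0 or
-- Q ≡ 0 (`regularity_or_curvatureNumerator_eq_zero`).
--
-- If Q ≡ 0, averaging over antipodal points leaves a quadratic polynomial in (a·x)² with leading
-- coefficient 9/2, which forces a = 0, that is ω₁ = ω₂ = ω₇ = 0. Now Q is affine in β·x. Its odd
-- part gives β = 0 or C = 2s² + 4c; its even part is C²/2 - C(2s² + 4c) + 2|β|² = 0. The value C =
-- 2s² + 4c yields the first system. If β = 0, then C = 4s² + 8c, which is the second system, or C =
-- 0, where s, c and d' all vanish and the second system is trivial. The case E ≡ 0 gives a = 0, β =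
-- 0, C = 0 and ends the same way (`curvature_systems`).

attribute [local instance] Matrix.linftyOpNormedRing Matrix.linftyOpNormedAlgebra

/-- Entrywise differentiable matrix curves have entrywise differentiable inverses. -/
lemma hasDerivAt_matrix_inv_apply {n : Type*} [Fintype n] [DecidableEq n]
    {γ : ℝ → Matrix n n ℝ} {γ' : Matrix n n ℝ} {h₀ : ℝ}
    (hγ : ∀ i j, HasDerivAt (fun h => γ h i j) (γ' i j) h₀) (hdet : (γ h₀).det ≠ 0) (i j : n) :
    HasDerivAt (fun h => (γ h)⁻¹ i j) (-((γ h₀)⁻¹ * γ' * (γ h₀)⁻¹) i j) h₀ := by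
  have hU : IsUnit (γ h₀) := (Matrix.isUnit_iff_isUnit_det _).2 (isUnit_iff_ne_zero.2 hdet)
  obtain ⟨x, hx⟩ := hU
  have hm : HasDerivAt γ γ' h₀ := by
    refine hasDerivAt_pi.2 fun i => hasDerivAt_pi.2 fun j => hγ i j
  have h1 := hasFDerivAt_ringInverse (𝕜 := ℝ) x
  rw [hx] at h1
  have h2 := h1.comp_hasDerivAt h₀ hm
  have h3 : HasDerivAt (fun h => (γ h)⁻¹) (-((γ h₀)⁻¹ * γ' * (γ h₀)⁻¹)) h₀ := by
    have hinv : ((x⁻¹ : (Matrix n n ℝ)ˣ) : Matrix n n ℝ) = (γ h₀)⁻¹ := by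
      rw [← hx, Matrix.coe_units_inv]
    -- The two inverses agree on singular matrices as well, so this is an equality of functions and
    -- not merely one near `h₀`.
    have h4 : (Ring.inverse ∘ γ) = fun h => (γ h)⁻¹ := by
      funext h
      exact (Matrix.nonsing_inv_eq_ringInverse _).symm
    rw [h4] at h2
    have hval : (-(ContinuousLinearMap.mulLeftRight ℝ (Matrix n n ℝ)) ↑x⁻¹ ↑x⁻¹) γ'
        = -((γ h₀)⁻¹ * γ' * (γ h₀)⁻¹) := by
      simp [hinv]
    exact hval ▸ h2
  exact hasDerivAt_pi.1 (hasDerivAt_pi.1 h3 i) j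

/-! ### Scalar curvature from the two-jet of a metric -/

noncomputable section

/-- The Christoffel symbols of the second kind computed from the inverse metric `H` and the first
derivatives `D` of the metric at a point. -/
def jetChristoffel (H : Matrix (Fin 3) (Fin 3) ℝ) (D : Fin 3 → Matrix (Fin 3) (Fin 3) ℝ)
    (l i j : Fin 3) : ℝ :=
  1 / 2 * ∑ m, H l m * (D j i m + D i j m - D m i j)

/-- The derivatives of the Christoffel symbols `Γ` in terms of the inverse metric `H` and the first
and second derivatives `D`, `DD` of the metric. -/
def jetDerivChristoffel (H : Matrix (Fin 3) (Fin 3) ℝ) (D : Fin 3 → Matrix (Fin 3) (Fin 3) ℝ)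
    (DD : Fin 3 → Fin 3 → Matrix (Fin 3) (Fin 3) ℝ) (Γ : Fin 3 → Fin 3 → Fin 3 → ℝ)
    (p l i j : Fin 3) : ℝ :=
  ∑ m, H l m * (1 / 2 * (DD p j i m + DD p i j m - DD p m i j) - ∑ n, D p m n * Γ n i j)

/-- The Ricci tensor formed from Christoffel symbols `Γ` and their derivatives `dΓ`. -/
def jetRicci (Γ : Fin 3 → Fin 3 → Fin 3 → ℝ) (dΓ : Fin 3 → Fin 3 → Fin 3 → Fin 3 → ℝ)
    (i j : Fin 3) : ℝ :=
  ∑ l, dΓ l l i j - ∑ l, dΓ j l i l + ∑ l, ∑ m, (Γ l i j * Γ m l m - Γ m i l * Γ l j m)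

/-- No regularity is required, so the formula holds along whole coordinate lines and can be
differentiated. -/
lemma christoffel_eq_jetChristoffel {g : (Fin 3 → ℝ) → Matrix (Fin 3) (Fin 3) ℝ}
    {D : Fin 3 → (Fin 3 → ℝ) → Matrix (Fin 3) (Fin 3) ℝ}
    (hD : ∀ u p i j, HasDerivAt (fun h => g (Function.update u p h) i j) (D p u i j) (u p))
    (l i j : Fin 3) (u : Fin 3 → ℝ) :
    christoffel g l i j u = jetChristoffel (g u)⁻¹ (fun p => D p u) l i j := by
  have h : ∀ p i j, partialDeriv p (fun v => g v i j) u = D p u i j :=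
    fun p i j => (hD u p i j).deriv
  simp only [christoffel, jetChristoffel, h]

/-- Differentiating the inverse metric gives -g⁻¹ (∂g) g⁻¹; the right-hand factor g⁻¹ recombines
with the first derivatives into Christoffel symbols, so only one explicit inverse remains. -/
lemma partialDeriv_christoffel {g : (Fin 3 → ℝ) → Matrix (Fin 3) (Fin 3) ℝ}
    {D : Fin 3 → (Fin 3 → ℝ) → Matrix (Fin 3) (Fin 3) ℝ}
    {DD : Fin 3 → Fin 3 → Matrix (Fin 3) (Fin 3) ℝ} {u : Fin 3 → ℝ}
    (hD : ∀ u p i j, HasDerivAt (fun h => g (Function.update u p h) i j) (D p u i j) (u p))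
    (hDD : ∀ p q i j,
      HasDerivAt (fun h => D q (Function.update u p h) i j) (DD p q i j) (u p))
    (hdet : (g u).det ≠ 0) (p l i j : Fin 3) :
    partialDeriv p (christoffel g l i j) u
      = jetDerivChristoffel (g u)⁻¹ (fun p => D p u) DD
          (jetChristoffel (g u)⁻¹ fun p => D p u) p l i j := by
  have hu : Function.update u p (u p) = u := Function.update_eq_self p u
  have hinv : ∀ m, HasDerivAt (fun h => (g (Function.update u p h))⁻¹ l m)
      (-((g u)⁻¹ * D p u * (g u)⁻¹) l m) (u p) := by
    intro m
    have := hasDerivAt_matrix_inv_apply (γ := fun h => g (Function.update u p h))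
      (γ' := D p u) (h₀ := u p) (hD u p) (by simpa only [hu] using hdet) l m
    simpa only [hu] using this
  have h1 : HasDerivAt (fun h => christoffel g l i j (Function.update u p h))
      (1 / 2 * ∑ m, (-((g u)⁻¹ * D p u * (g u)⁻¹) l m * (D j u i m + D i u j m - D m u i j)
        + (g u)⁻¹ l m * (DD p j i m + DD p i j m - DD p m i j))) (u p) := by
    simp only [christoffel_eq_jetChristoffel hD, jetChristoffel]
    refine HasDerivAt.const_mul _ (HasDerivAt.fun_sum fun m _ => ?_)
    have := (hinv m).fun_mul (((hDD p j i m).fun_add (hDD p i j m)).fun_sub (hDD p m i j))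
    simpa only [hu] using this
  rw [partialDeriv, h1.deriv]
  simp only [jetDerivChristoffel, jetChristoffel, Matrix.mul_apply, Fin.sum_univ_three]
  ring

lemma scalarCurvature_eq_jet {g : (Fin 3 → ℝ) → Matrix (Fin 3) (Fin 3) ℝ}
    {D : Fin 3 → (Fin 3 → ℝ) → Matrix (Fin 3) (Fin 3) ℝ}
    {DD : Fin 3 → Fin 3 → Matrix (Fin 3) (Fin 3) ℝ} {u : Fin 3 → ℝ}
    (hD : ∀ u p i j, HasDerivAt (fun h => g (Function.update u p h) i j) (D p u i j) (u p))
    (hDD : ∀ p q i j,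
      HasDerivAt (fun h => D q (Function.update u p h) i j) (DD p q i j) (u p))
    (hdet : (g u).det ≠ 0) :
    scalarCurvature g u = ∑ i, ∑ j, (g u)⁻¹ i j *
      jetRicci (jetChristoffel (g u)⁻¹ fun p => D p u)
        (jetDerivChristoffel (g u)⁻¹ (fun p => D p u) DD
          (jetChristoffel (g u)⁻¹ fun p => D p u)) i j := by
  simp only [scalarCurvature, ricci, partialDeriv_christoffel hD hDD hdet,
    christoffel_eq_jetChristoffel hD, jetRicci]

end

/-! ### Curvature at t = 0 as algebra in the spherical frame -/

noncomputable section

/-- The symmetric matrix with the given entries on and above the diagonal. -/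
def symmMatrix (m₀₀ m₀₁ m₀₂ m₁₁ m₁₂ m₂₂ : ℝ) : Matrix (Fin 3) (Fin 3) ℝ :=
  !![m₀₀, m₀₁, m₀₂; m₀₁, m₁₁, m₁₂; m₀₂, m₁₂, m₂₂]

@[simp] lemma symmMatrix_apply_00 (m₀₀ m₀₁ m₀₂ m₁₁ m₁₂ m₂₂ : ℝ) :
    symmMatrix m₀₀ m₀₁ m₀₂ m₁₁ m₁₂ m₂₂ 0 0 = m₀₀ := rfl

@[simp] lemma symmMatrix_apply_01 (m₀₀ m₀₁ m₀₂ m₁₁ m₁₂ m₂₂ : ℝ) :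
    symmMatrix m₀₀ m₀₁ m₀₂ m₁₁ m₁₂ m₂₂ 0 1 = m₀₁ := rfl

@[simp] lemma symmMatrix_apply_02 (m₀₀ m₀₁ m₀₂ m₁₁ m₁₂ m₂₂ : ℝ) :
    symmMatrix m₀₀ m₀₁ m₀₂ m₁₁ m₁₂ m₂₂ 0 2 = m₀₂ := rfl

@[simp] lemma symmMatrix_apply_10 (m₀₀ m₀₁ m₀₂ m₁₁ m₁₂ m₂₂ : ℝ) :
    symmMatrix m₀₀ m₀₁ m₀₂ m₁₁ m₁₂ m₂₂ 1 0 = m₀₁ := rfl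

@[simp] lemma symmMatrix_apply_11 (m₀₀ m₀₁ m₀₂ m₁₁ m₁₂ m₂₂ : ℝ) :
    symmMatrix m₀₀ m₀₁ m₀₂ m₁₁ m₁₂ m₂₂ 1 1 = m₁₁ := rfl

@[simp] lemma symmMatrix_apply_12 (m₀₀ m₀₁ m₀₂ m₁₁ m₁₂ m₂₂ : ℝ) :
    symmMatrix m₀₀ m₀₁ m₀₂ m₁₁ m₁₂ m₂₂ 1 2 = m₁₂ := rfl

@[simp] lemma symmMatrix_apply_20 (m₀₀ m₀₁ m₀₂ m₁₁ m₁₂ m₂₂ : ℝ) :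
    symmMatrix m₀₀ m₀₁ m₀₂ m₁₁ m₁₂ m₂₂ 2 0 = m₀₂ := rfl

@[simp] lemma symmMatrix_apply_21 (m₀₀ m₀₁ m₀₂ m₁₁ m₁₂ m₂₂ : ℝ) :
    symmMatrix m₀₀ m₀₁ m₀₂ m₁₁ m₁₂ m₂₂ 2 1 = m₁₂ := rfl

@[simp] lemma symmMatrix_apply_22 (m₀₀ m₀₁ m₀₂ m₁₁ m₁₂ m₂₂ : ℝ) :
    symmMatrix m₀₀ m₀₁ m₀₂ m₁₁ m₁₂ m₂₂ 2 2 = m₂₂ := rfl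

/-- The inverse of the metric at `t = 0`, in terms of the components of `a` in the spherical
frame, `k = cos φ` and the regularity function `E`. -/
def frameInv (k a₁ a₂ E : ℝ) : Matrix (Fin 3) (Fin 3) ℝ :=
  symmMatrix (1 / E) (-a₂ / (k * E)) (a₁ / E) ((1 + a₂ ^ 2 / E) / k ^ 2) (-a₁ * a₂ / (k * E))
    (1 + a₁ ^ 2 / E)

/-- The first derivatives of the metric at `t = 0`; `aᵢ` and `fᵢ` are the components of the
rotation vector and of the translation vector in the spherical frame. -/
def frameD (k S a₀ a₁ a₂ f₁ f₂ s : ℝ) : Fin 3 → Matrix (Fin 3) (Fin 3) ℝ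
  | 0 => symmMatrix 0 (-k * f₁) (-f₂) (2 * s * k ^ 2) 0 (2 * s)
  | 1 => symmMatrix (-2 * k * f₁) (-k * S * a₁) (k * a₀ - S * a₂) 0 0 0
  | 2 => symmMatrix (-2 * f₂) (-S * a₂ - k * a₀) 0 (-2 * k * S) 0 0

/-- The second derivatives of the metric at `t = 0`. -/
def frameDD (k S a₀ a₁ a₂ f₀ f₁ f₂ s c : ℝ) : Fin 3 → Fin 3 → Matrix (Fin 3) (Fin 3) ℝ
  | 0, 0 => symmMatrix 0 0 0 (2 * (s ^ 2 + c) * k ^ 2) 0 (2 * (s ^ 2 + c))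
  | 0, 1 | 1, 0 => symmMatrix 0 (-k * (-k * f₀ + S * f₂)) (S * f₁) 0 0 0
  | 0, 2 | 2, 0 => symmMatrix 0 (S * f₁) f₀ (-4 * s * k * S) 0 0
  | 1, 1 => symmMatrix (-2 * k * (-k * f₀ + S * f₂)) (-k * S * (-k * a₀ + S * a₂)) a₁ 0 0 0
  | 1, 2 | 2, 1 => symmMatrix (2 * S * f₁) ((S ^ 2 - k ^ 2) * a₁) 0 0 0 0
  | 2, 2 => symmMatrix (2 * f₀) (2 * S * a₀ - 2 * k * a₂) 0 (2 * S ^ 2 - 2 * k ^ 2) 0 0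

/-- The Christoffel symbols at `t = 0`. -/
def frameChristoffel (k S a₀ a₁ a₂ f₁ f₂ s w : ℝ) : Fin 3 → Matrix (Fin 3) (Fin 3) ℝ
  | 0 => symmMatrix 0 (w * k * (a₀ * a₁ - f₁ - s * a₂)) (w * (-f₂ + a₀ * a₂ + s * a₁))
      (-w * s * k ^ 2) 0 (-w * s)
  | 1 => symmMatrix 0 (s - w * (a₀ * a₁ - f₁ - s * a₂) * a₂)
      ((-a₀ - w * (-f₂ + a₀ * a₂ + s * a₁) * a₂) / k) (w * s * k * a₂) (-S / k) (w * s * a₂ / k)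
  | 2 => symmMatrix 0 (k * a₀ + w * k * (a₀ * a₁ - f₁ - s * a₂) * a₁)
      (s + w * (-f₂ + a₀ * a₂ + s * a₁) * a₁) (k * S - w * s * k ^ 2 * a₁) 0 (-w * s * a₁)

/-- The Ricci tensor at `t = 0`. -/
def frameRicci (k a₀ a₁ a₂ f₁ f₂ s c w : ℝ) : Matrix (Fin 3) (Fin 3) ℝ :=
  symmMatrix
    (- 2 * c + 2 * a₀ ^ 2 + w * f₂ ^ 2 + w * f₁ ^ 2 + 2 * w * a₂ * f₁ * s - w * a₂ ^ 2 * c + w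
      * a₂ ^ 2 * s ^ 2 - 2 * w * a₁ * f₂ * s - w * a₁ ^ 2 * c + w * a₁ ^ 2 * s ^ 2 - 2 * w * a₀
      * a₂ * f₂ - 2 * w * a₀ * a₁ * f₁ + 2 * w * a₀ ^ 2 * a₂ ^ 2 + 2 * w * a₀ ^ 2 * a₁ ^ 2 + w
      ^ 2 * a₂ ^ 2 * f₁ ^ 2 + 2 * w ^ 2 * a₂ ^ 3 * f₁ * s + w ^ 2 * a₂ ^ 4 * s ^ 2 - 2 * w ^ 2
      * a₁ * a₂ * f₁ * f₂ - 2 * w ^ 2 * a₁ * a₂ ^ 2 * f₂ * s + w ^ 2 * a₁ ^ 2 * f₂ ^ 2 + 2 * w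
      ^ 2 * a₁ ^ 2 * a₂ * f₁ * s + 2 * w ^ 2 * a₁ ^ 2 * a₂ ^ 2 * s ^ 2 - 2 * w ^ 2 * a₁ ^ 3 *
      f₂ * s + w ^ 2 * a₁ ^ 4 * s ^ 2)
    (k * a₂ - k * w * f₁ * s - k * w * a₂ * c - k * w * a₂ * s ^ 2 + k * w * a₀ * a₁ * s + k *
      w * a₀ ^ 2 * a₂ + k * w ^ 2 * a₂ * f₁ ^ 2 + 2 * k * w ^ 2 * a₂ ^ 2 * f₁ * s + k * w ^ 2 *
      a₂ ^ 3 * s ^ 2 - k * w ^ 2 * a₁ * f₁ * f₂ - 2 * k * w ^ 2 * a₁ * a₂ * f₂ * s + k * w ^ 2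
      * a₁ ^ 2 * a₂ * s ^ 2 - k * w ^ 2 * a₀ * a₁ * a₂ * f₁ + k * w ^ 2 * a₀ * a₁ ^ 2 * f₂)
    (- a₁ - w * f₂ * s + w * a₁ * c + w * a₁ * s ^ 2 + w * a₀ * a₂ * s - w * a₀ ^ 2 * a₁ + w ^
      2 * a₂ * f₁ * f₂ - w ^ 2 * a₁ * f₂ ^ 2 - 2 * w ^ 2 * a₁ * a₂ * f₁ * s - w ^ 2 * a₁ * a₂ ^
      2 * s ^ 2 + 2 * w ^ 2 * a₁ ^ 2 * f₂ * s - w ^ 2 * a₁ ^ 3 * s ^ 2 - w ^ 2 * a₀ * a₂ ^ 2 *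
      f₁ + w ^ 2 * a₀ * a₁ * a₂ * f₂)
    (k ^ 2 - k ^ 2 * w * c - k ^ 2 * w * s ^ 2 - k ^ 2 * w * a₁ ^ 2 + k ^ 2 * w * a₀ ^ 2 + k ^
      2 * w ^ 2 * f₁ ^ 2 + 2 * k ^ 2 * w ^ 2 * a₂ * f₁ * s + k ^ 2 * w ^ 2 * a₂ ^ 2 * s ^ 2 - 2
      * k ^ 2 * w ^ 2 * a₁ * f₂ * s + k ^ 2 * w ^ 2 * a₁ ^ 2 * s ^ 2 - 2 * k ^ 2 * w ^ 2 * a₀ *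
      a₁ * f₁ + k ^ 2 * w ^ 2 * a₀ ^ 2 * a₁ ^ 2)
    (- k * w * a₁ * a₂ + k * w ^ 2 * f₁ * f₂ - k * w ^ 2 * a₀ * a₂ * f₁ - k * w ^ 2 * a₀ * a₁
      * f₂ + k * w ^ 2 * a₀ ^ 2 * a₁ * a₂)
    (1 - w * c - w * s ^ 2 - w * a₂ ^ 2 + w * a₀ ^ 2 + w ^ 2 * f₂ ^ 2 + 2 * w ^ 2 * a₂ * f₁ *
      s + w ^ 2 * a₂ ^ 2 * s ^ 2 - 2 * w ^ 2 * a₁ * f₂ * s + w ^ 2 * a₁ ^ 2 * s ^ 2 - 2 * w ^ 2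
      * a₀ * a₂ * f₂ + w ^ 2 * a₀ ^ 2 * a₂ ^ 2)

lemma jetChristoffel_frame {k S a₀ a₁ a₂ f₁ f₂ s E : ℝ} (hk : k ≠ 0) (hE : E ≠ 0)
    (l i j : Fin 3) :
    jetChristoffel (frameInv k a₁ a₂ E) (frameD k S a₀ a₁ a₂ f₁ f₂ s) l i j
      = frameChristoffel k S a₀ a₁ a₂ f₁ f₂ s (1 / E) l i j := by
  fin_cases l <;> fin_cases i <;> fin_cases j <;>
    simp [jetChristoffel, frameInv, frameD, frameChristoffel, symmMatrix, Fin.sum_univ_three] <;>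
    field_simp <;> ring


-- Here k and S stand for cos φ and sin φ, so the claim is a rational identity modulo S² + k² = 1.
-- The radial component f₀ of β enters the second derivatives but cancels from the Ricci tensor, and
-- so does S.
set_option linter.unusedSimpArgs false in
lemma jetRicci_frame {k S a₀ a₁ a₂ f₀ f₁ f₂ s c E : ℝ} (hk : k ≠ 0) (hE : E ≠ 0)
    (hkS : S ^ 2 = 1 - k ^ 2) (i j : Fin 3) :
    jetRicci (fun l => frameChristoffel k S a₀ a₁ a₂ f₁ f₂ s (1 / E) l)
      (jetDerivChristoffel (frameInv k a₁ a₂ E) (frameD k S a₀ a₁ a₂ f₁ f₂ s)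
        (frameDD k S a₀ a₁ a₂ f₀ f₁ f₂ s c)
        fun l => frameChristoffel k S a₀ a₁ a₂ f₁ f₂ s (1 / E) l) i j
      = frameRicci k a₀ a₁ a₂ f₁ f₂ s c (1 / E) i j := by
  have hS3 : S ^ 3 = S * (1 - k ^ 2) := by rw [← hkS]; ring
  have hS4 : S ^ 4 = (1 - k ^ 2) ^ 2 := by rw [← hkS]; ring
  match i, j with
  | 0, 0 | 0, 1 | 0, 2 | 1, 0 | 1, 1 | 1, 2 | 2, 0 | 2, 1 | 2, 2 =>
    simp only [jetRicci, jetDerivChristoffel, frameInv, frameD, frameDD, frameChristoffel, frameRicci,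
      Fin.sum_univ_three, symmMatrix_apply_00, symmMatrix_apply_01, symmMatrix_apply_02,
      symmMatrix_apply_10, symmMatrix_apply_11, symmMatrix_apply_12, symmMatrix_apply_20,
      symmMatrix_apply_21, symmMatrix_apply_22, mul_zero, zero_mul, add_zero, zero_add,
      sub_zero, zero_sub]
    field_simp
    ring_nf
    try
      simp only [hkS, hS3, hS4]
      ring

lemma jetScalarCurvature_frame {k S a₀ a₁ a₂ f₀ f₁ f₂ s c E : ℝ} (hk : k ≠ 0) (hE : E ≠ 0)
    (hkS : S ^ 2 = 1 - k ^ 2) :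
    (∑ i, ∑ j, frameInv k a₁ a₂ E i j *
      jetRicci (jetChristoffel (frameInv k a₁ a₂ E) (frameD k S a₀ a₁ a₂ f₁ f₂ s))
        (jetDerivChristoffel (frameInv k a₁ a₂ E) (frameD k S a₀ a₁ a₂ f₁ f₂ s)
          (frameDD k S a₀ a₁ a₂ f₀ f₁ f₂ s c)
          (jetChristoffel (frameInv k a₁ a₂ E) (frameD k S a₀ a₁ a₂ f₁ f₂ s))) i j) * E ^ 2
    = 2 * E ^ 2 + E * (-2 * s ^ 2 - 4 * c - 2 * (a₁ ^ 2 + a₂ ^ 2) + 4 * a₀ ^ 2)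
      + 8 * s * (a₂ * f₁ - a₁ * f₂) + 4 * s ^ 2 * (a₁ ^ 2 + a₂ ^ 2)
      + 2 * ((a₀ * a₁ - f₁) ^ 2 + (a₀ * a₂ - f₂) ^ 2) := by
  have hΓ : jetChristoffel (frameInv k a₁ a₂ E) (frameD k S a₀ a₁ a₂ f₁ f₂ s)
      = fun l => frameChristoffel k S a₀ a₁ a₂ f₁ f₂ s (1 / E) l := by
    funext l i j
    exact jetChristoffel_frame hk hE l i j
  simp only [hΓ, jetRicci_frame hk hE hkS]
  simp only [frameInv, frameRicci, Fin.sum_univ_three, symmMatrix_apply_00, symmMatrix_apply_01,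
    symmMatrix_apply_02, symmMatrix_apply_10, symmMatrix_apply_11, symmMatrix_apply_12,
    symmMatrix_apply_20, symmMatrix_apply_21, symmMatrix_apply_22]
  field_simp
  ring

end

/-! ### The model metric, its derivatives and its scalar curvature -/

noncomputable section

/-- The radial component of `v` in the spherical frame. -/
def radComp (v : Fin 3 → ℝ) (θ φ : ℝ) : ℝ :=
  v 0 * (Real.cos θ * Real.cos φ) + v 1 * (Real.sin θ * Real.cos φ) + v 2 * Real.sin φ

/-- The azimuthal component of `v` in the spherical frame. -/
def azComp (v : Fin 3 → ℝ) (θ : ℝ) : ℝ :=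
  v 1 * Real.cos θ - v 0 * Real.sin θ

/-- The polar component of `v` in the spherical frame. -/
def polComp (v : Fin 3 → ℝ) (θ φ : ℝ) : ℝ :=
  v 2 * Real.cos φ - v 0 * (Real.cos θ * Real.sin φ) - v 1 * (Real.sin θ * Real.sin φ)

/-- Differentiation in θ and φ maps the three frame components of a constant vector to combinations
of one another with coefficients in cos φ and sin φ. This closed system is what makes every
derivative of the metric algebraic in the frame components. -/
lemma hasDerivAt_radComp_az (v : Fin 3 → ℝ) (θ φ : ℝ) :
    HasDerivAt (fun h => radComp v h φ) (Real.cos φ * azComp v θ) θ := by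
  have := ((((Real.hasDerivAt_cos θ).mul_const (Real.cos φ)).const_mul (v 0)).fun_add
    (((Real.hasDerivAt_sin θ).mul_const (Real.cos φ)).const_mul (v 1))).add_const
    (v 2 * Real.sin φ)
  exact this.congr_deriv (by simp only [azComp]; ring)

lemma hasDerivAt_radComp_pol (v : Fin 3 → ℝ) (θ φ : ℝ) :
    HasDerivAt (fun h => radComp v θ h) (polComp v θ φ) φ := by
  have := ((((Real.hasDerivAt_cos φ).const_mul (Real.cos θ)).const_mul (v 0)).fun_add
    (((Real.hasDerivAt_cos φ).const_mul (Real.sin θ)).const_mul (v 1))).fun_add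
    ((Real.hasDerivAt_sin φ).const_mul (v 2))
  exact this.congr_deriv (by simp only [polComp]; ring)

lemma hasDerivAt_azComp (v : Fin 3 → ℝ) (θ φ : ℝ) :
    HasDerivAt (fun h => azComp v h)
      (-Real.cos φ * radComp v θ φ + Real.sin φ * polComp v θ φ) θ := by
  have := ((Real.hasDerivAt_cos θ).const_mul (v 1)).fun_sub
    ((Real.hasDerivAt_sin θ).const_mul (v 0))
  refine this.congr_deriv ?_
  simp only [radComp, polComp]
  linear_combination (v 0 * Real.cos θ + v 1 * Real.sin θ) * Real.sin_sq_add_cos_sq φ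

lemma hasDerivAt_polComp_az (v : Fin 3 → ℝ) (θ φ : ℝ) :
    HasDerivAt (fun h => polComp v h φ) (-Real.sin φ * azComp v θ) θ := by
  have := (((((Real.hasDerivAt_cos θ).mul_const (Real.sin φ)).const_mul (v 0)).const_sub
    (v 2 * Real.cos φ))).fun_sub
    (((Real.hasDerivAt_sin θ).mul_const (Real.sin φ)).const_mul (v 1))
  exact this.congr_deriv (by simp only [azComp]; ring)

lemma hasDerivAt_polComp_pol (v : Fin 3 → ℝ) (θ φ : ℝ) :
    HasDerivAt (fun h => polComp v θ h) (-radComp v θ φ) φ := by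
  have := (((Real.hasDerivAt_cos φ).const_mul (v 2)).fun_sub
    (((Real.hasDerivAt_sin φ).const_mul (Real.cos θ)).const_mul (v 0))).fun_sub
    (((Real.hasDerivAt_sin φ).const_mul (Real.sin θ)).const_mul (v 1))
  exact this.congr_deriv (by simp only [radComp]; ring)

lemma hasDerivAt_symmMatrix {m₀₀ m₀₁ m₀₂ m₁₁ m₁₂ m₂₂ : ℝ → ℝ} {d₀₀ d₀₁ d₀₂ d₁₁ d₁₂ d₂₂ x : ℝ}
    (h₀₀ : HasDerivAt m₀₀ d₀₀ x) (h₀₁ : HasDerivAt m₀₁ d₀₁ x) (h₀₂ : HasDerivAt m₀₂ d₀₂ x)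
    (h₁₁ : HasDerivAt m₁₁ d₁₁ x) (h₁₂ : HasDerivAt m₁₂ d₁₂ x) (h₂₂ : HasDerivAt m₂₂ d₂₂ x)
    (i j : Fin 3) :
    HasDerivAt (fun h => symmMatrix (m₀₀ h) (m₀₁ h) (m₀₂ h) (m₁₁ h) (m₁₂ h) (m₂₂ h) i j)
      (symmMatrix d₀₀ d₀₁ d₀₂ d₁₁ d₁₂ d₂₂ i j) x := by
  fin_cases i <;> fin_cases j <;> assumption

/-- The metric of a kinematic surface in the coordinates `(t, θ, φ)`, where `a` is the rotation
vector, `β` the tangential and `C` the total squared size of the velocity, `s` the scaling velocity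
and `c` the common squared length of the columns of the rotational part. -/
def kinMetric (a β : Fin 3 → ℝ) (C s c : ℝ) (u : Fin 3 → ℝ) : Matrix (Fin 3) (Fin 3) ℝ :=
  symmMatrix (C - 2 * radComp β (u 1) (u 2))
    (Real.cos (u 2) * (polComp a (u 1) (u 2) - u 0 * azComp β (u 1)))
    (-azComp a (u 1) - u 0 * polComp β (u 1) (u 2))
    ((1 + 2 * s * u 0 + (s ^ 2 + c) * u 0 ^ 2) * Real.cos (u 2) ^ 2) 0
    (1 + 2 * s * u 0 + (s ^ 2 + c) * u 0 ^ 2)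

/-- The first derivatives of `kinMetric`. -/
def kinMetricD (a β : Fin 3 → ℝ) (s c : ℝ) : Fin 3 → (Fin 3 → ℝ) → Matrix (Fin 3) (Fin 3) ℝ
  | 0, u => symmMatrix 0 (-Real.cos (u 2) * azComp β (u 1)) (-polComp β (u 1) (u 2))
      ((2 * s + 2 * (s ^ 2 + c) * u 0) * Real.cos (u 2) ^ 2) 0 (2 * s + 2 * (s ^ 2 + c) * u 0)
  | 1, u => symmMatrix (-2 * Real.cos (u 2) * azComp β (u 1))
      (Real.cos (u 2) * (-Real.sin (u 2) * azComp a (u 1) - u 0 *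
        (-Real.cos (u 2) * radComp β (u 1) (u 2) + Real.sin (u 2) * polComp β (u 1) (u 2))))
      (Real.cos (u 2) * radComp a (u 1) (u 2) - Real.sin (u 2) * polComp a (u 1) (u 2)
        + u 0 * (Real.sin (u 2) * azComp β (u 1))) 0 0 0
  | 2, u => symmMatrix (-2 * polComp β (u 1) (u 2))
      (-Real.sin (u 2) * (polComp a (u 1) (u 2) - u 0 * azComp β (u 1))
        - Real.cos (u 2) * radComp a (u 1) (u 2))
      (u 0 * radComp β (u 1) (u 2))
      (-2 * Real.cos (u 2) * Real.sin (u 2) * (1 + 2 * s * u 0 + (s ^ 2 + c) * u 0 ^ 2)) 0 0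

lemma hasDerivAt_quadratic (b c t : ℝ) :
    HasDerivAt (fun h : ℝ => 1 + 2 * b * h + c * h ^ 2) (2 * b + 2 * c * t) t := by
  have := (((hasDerivAt_id t).const_mul (2 * b)).const_add 1).fun_add
    (((hasDerivAt_id t).fun_pow 2).const_mul c)
  exact this.congr_deriv (by simp; ring)

lemma hasDerivAt_kinMetric (a β : Fin 3 → ℝ) (C s c : ℝ) (u : Fin 3 → ℝ) (p i j : Fin 3) :
    HasDerivAt (fun h => kinMetric a β C s c (Function.update u p h) i j)
      (kinMetricD a β s c p u i j) (u p) := by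
  have hq := hasDerivAt_quadratic s (s ^ 2 + c) (u 0)
  have hid := hasDerivAt_id (u 0)
  match p with
  | 0 =>
    simp only [kinMetric, kinMetricD, Function.update_self, ne_eq, one_ne_zero,
      not_false_eq_true, Function.update_of_ne, Fin.reduceEq]
    refine hasDerivAt_symmMatrix (hasDerivAt_const _ _) ?_ ?_ (hq.mul_const _)
      (hasDerivAt_const _ _) hq i j
    · exact (((hid.mul_const _).const_sub _).const_mul _).congr_deriv (by ring)
    · exact ((hid.mul_const _).const_sub _).congr_deriv (by ring)
  | 1 =>
    simp only [kinMetric, kinMetricD, Function.update_self, ne_eq, zero_ne_one,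
      not_false_eq_true, Function.update_of_ne, Fin.reduceEq]
    refine hasDerivAt_symmMatrix ?_ ?_ ?_ (hasDerivAt_const _ _)
      (hasDerivAt_const _ _) (hasDerivAt_const _ _) i j
    · exact (((hasDerivAt_radComp_az β _ _).const_mul _).const_sub _).congr_deriv (by ring)
    · exact (((hasDerivAt_polComp_az a _ _).fun_sub
        ((hasDerivAt_azComp β _ (u 2)).const_mul _)).const_mul _)
    · exact ((hasDerivAt_azComp a _ (u 2)).fun_neg.fun_sub
        ((hasDerivAt_polComp_az β _ _).const_mul _)).congr_deriv (by ring)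
  | 2 =>
    simp only [kinMetric, kinMetricD, Function.update_self, ne_eq,
      not_false_eq_true, Function.update_of_ne, Fin.reduceEq]
    refine hasDerivAt_symmMatrix ?_ ?_ ?_ ?_
      (hasDerivAt_const _ _) (hasDerivAt_const _ _) i j
    · exact (((hasDerivAt_radComp_pol β _ _).const_mul _).const_sub _).congr_deriv (by ring)
    · exact ((Real.hasDerivAt_cos _).fun_mul
        ((hasDerivAt_polComp_pol a _ _).sub_const _)).congr_deriv (by ring)
    · exact (((hasDerivAt_polComp_pol β _ _).const_mul _).const_sub _).congr_deriv (by ring)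
    · exact (((Real.hasDerivAt_cos _).fun_pow 2).const_mul _).congr_deriv (by simp; ring)

/-- At `t = 0` the first derivatives of `kinMetric` are expressed by the spherical frame. -/
lemma kinMetricD_zero (a β : Fin 3 → ℝ) (s c θ φ : ℝ) (p : Fin 3) :
    kinMetricD a β s c p ![0, θ, φ] = frameD (Real.cos φ) (Real.sin φ) (radComp a θ φ)
      (azComp a θ) (polComp a θ φ) (azComp β θ) (polComp β θ φ) s p := by
  match p with
  | 0 | 1 | 2 =>
    simp only [kinMetricD, frameD, Matrix.cons_val_zero, Matrix.cons_val_one, Matrix.cons_val]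
    congr 1 <;> ring

set_option linter.unusedSimpArgs false in
lemma hasDerivAt_kinMetricD (a β : Fin 3 → ℝ) (s c θ φ : ℝ) (p q i j : Fin 3) :
    HasDerivAt (fun h => kinMetricD a β s c q (Function.update ![0, θ, φ] p h) i j)
      (frameDD (Real.cos φ) (Real.sin φ) (radComp a θ φ) (azComp a θ) (polComp a θ φ)
        (radComp β θ φ) (azComp β θ) (polComp β θ φ) s c p q i j)
      ((![0, θ, φ] : Fin 3 → ℝ) p) := by
  have hid := hasDerivAt_id (0 : ℝ)
  have hc := Real.hasDerivAt_cos φ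
  have hs := Real.hasDerivAt_sin φ
  have hl : HasDerivAt (fun h : ℝ => 2 * s + 2 * (s ^ 2 + c) * h) (2 * (s ^ 2 + c)) 0 :=
    ((hid.const_mul _).const_add _).congr_deriv (by simp)
  have hq : HasDerivAt (fun h : ℝ => 1 + 2 * s * h + (s ^ 2 + c) * h ^ 2) (2 * s) 0 :=
    (hasDerivAt_quadratic s (s ^ 2 + c) 0).congr_deriv (by simp)
  have hcc : HasDerivAt (fun h => Real.cos h ^ 2) (-2 * Real.cos φ * Real.sin φ) φ :=
    (hc.fun_pow 2).congr_deriv (by simp)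
  have hr1 := fun v => hasDerivAt_radComp_az v θ φ
  have hr2 := fun v => hasDerivAt_radComp_pol v θ φ
  have ha := fun v => hasDerivAt_azComp v θ φ
  have hp1 := fun v => hasDerivAt_polComp_az v θ φ
  have hp2 := fun v => hasDerivAt_polComp_pol v θ φ
  have hS := Real.sin_sq_add_cos_sq φ
  match p, q with
  | 0, 0 =>
    simp only [kinMetricD, frameDD, Function.update_self, ne_eq, one_ne_zero, zero_ne_one,
      not_false_eq_true, Function.update_of_ne, Fin.reduceEq, Matrix.cons_val_zero,
      Matrix.cons_val_one, Matrix.cons_val]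
    exact hasDerivAt_symmMatrix (hasDerivAt_const _ _) (hasDerivAt_const _ _)
      (hasDerivAt_const _ _) (hl.mul_const _) (hasDerivAt_const _ _) hl i j
  | 0, 1 =>
    simp only [kinMetricD, frameDD, Function.update_self, ne_eq, one_ne_zero, zero_ne_one,
      not_false_eq_true, Function.update_of_ne, Fin.reduceEq, Matrix.cons_val_zero,
      Matrix.cons_val_one, Matrix.cons_val]
    refine hasDerivAt_symmMatrix (hasDerivAt_const _ _) ?_ ?_
      (hasDerivAt_const _ _) (hasDerivAt_const _ _) (hasDerivAt_const _ _) i j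
    · exact (((hid.mul_const _).const_sub _).const_mul _).congr_deriv (by ring)
    · exact ((hid.mul_const _).const_add _).congr_deriv (by ring)
  | 0, 2 =>
    simp only [kinMetricD, frameDD, Function.update_self, ne_eq, one_ne_zero, zero_ne_one,
      not_false_eq_true, Function.update_of_ne, Fin.reduceEq, Matrix.cons_val_zero,
      Matrix.cons_val_one, Matrix.cons_val]
    refine hasDerivAt_symmMatrix (hasDerivAt_const _ _) ?_ ?_
      ?_ (hasDerivAt_const _ _) (hasDerivAt_const _ _) i j
    · exact ((((hid.mul_const _).const_sub _).const_mul _).sub_const _).congr_deriv (by ring)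
    · exact (hid.mul_const _).congr_deriv (by ring)
    · exact (hq.const_mul _).congr_deriv (by ring)
  | 1, 0 =>
    simp only [kinMetricD, frameDD, Function.update_self, ne_eq, one_ne_zero, zero_ne_one,
      not_false_eq_true, Function.update_of_ne, Fin.reduceEq, Matrix.cons_val_zero,
      Matrix.cons_val_one, Matrix.cons_val]
    refine hasDerivAt_symmMatrix (hasDerivAt_const _ _) ?_ ?_
      (hasDerivAt_const _ _) (hasDerivAt_const _ _) (hasDerivAt_const _ _) i j
    · exact ((ha β).const_mul _)
    · exact (hp1 β).fun_neg.congr_deriv (by ring)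
  | 1, 1 =>
    simp only [kinMetricD, frameDD, Function.update_self, ne_eq, one_ne_zero, zero_ne_one,
      not_false_eq_true, Function.update_of_ne, Fin.reduceEq, Matrix.cons_val_zero,
      Matrix.cons_val_one, Matrix.cons_val, zero_mul, sub_zero, add_zero]
    refine hasDerivAt_symmMatrix ?_ ?_ ?_
      (hasDerivAt_const _ _) (hasDerivAt_const _ _) (hasDerivAt_const _ _) i j
    · exact ((ha β).const_mul _)
    · exact (((ha a).const_mul _).const_mul _).congr_deriv (by ring)
    · exact (((hr1 a).const_mul _).fun_sub ((hp1 a).const_mul _)).congr_deriv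
        (by linear_combination azComp a θ * hS)
  | 1, 2 =>
    simp only [kinMetricD, frameDD, Function.update_self, ne_eq, one_ne_zero, zero_ne_one,
      not_false_eq_true, Function.update_of_ne, Fin.reduceEq, Matrix.cons_val_zero,
      Matrix.cons_val_one, Matrix.cons_val, zero_mul, sub_zero, add_zero]
    refine hasDerivAt_symmMatrix ?_ ?_ (hasDerivAt_const _ _)
      (hasDerivAt_const _ _) (hasDerivAt_const _ _) (hasDerivAt_const _ _) i j
    · exact ((hp1 β).const_mul _).congr_deriv (by ring)
    · exact (((hp1 a).const_mul _).fun_sub ((hr1 a).const_mul _)).congr_deriv (by ring)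
  | 2, 0 =>
    simp only [kinMetricD, frameDD, Function.update_self, ne_eq, one_ne_zero, zero_ne_one,
      not_false_eq_true, Function.update_of_ne, Fin.reduceEq, Matrix.cons_val_zero,
      Matrix.cons_val_one, Matrix.cons_val, mul_zero, add_zero]
    refine hasDerivAt_symmMatrix (hasDerivAt_const _ _) ?_ ?_
      ?_ (hasDerivAt_const _ _) (hasDerivAt_const _ _) i j
    · exact (hc.fun_neg.mul_const _).congr_deriv (by ring)
    · exact (hp2 β).fun_neg.congr_deriv (by ring)
    · exact (hcc.const_mul _).congr_deriv (by ring)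
  | 2, 1 =>
    simp only [kinMetricD, frameDD, Function.update_self, ne_eq, one_ne_zero, zero_ne_one,
      not_false_eq_true, Function.update_of_ne, Fin.reduceEq, Matrix.cons_val_zero,
      Matrix.cons_val_one, Matrix.cons_val, zero_mul, sub_zero, add_zero]
    refine hasDerivAt_symmMatrix ?_ ?_ ?_
      (hasDerivAt_const _ _) (hasDerivAt_const _ _) (hasDerivAt_const _ _) i j
    · exact ((hc.const_mul _).mul_const _).congr_deriv (by ring)
    · exact (hc.fun_mul (hs.fun_neg.mul_const _)).congr_deriv (by ring)
    · exact ((hc.fun_mul (hr2 a)).fun_sub (hs.fun_mul (hp2 a))).congr_deriv (by ring)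
  | 2, 2 =>
    simp only [kinMetricD, frameDD, Function.update_self, ne_eq, one_ne_zero, zero_ne_one,
      not_false_eq_true, Function.update_of_ne, Fin.reduceEq, Matrix.cons_val_zero,
      Matrix.cons_val_one, Matrix.cons_val, zero_mul, mul_zero, sub_zero, add_zero]
    refine hasDerivAt_symmMatrix ?_ ?_ (hasDerivAt_const _ _)
      ?_ (hasDerivAt_const _ _) (hasDerivAt_const _ _) i j
    · exact ((hp2 β).const_mul _).congr_deriv (by ring)
    · exact ((hs.fun_neg.fun_mul (hp2 a)).fun_sub (hc.fun_mul (hr2 a))).congr_deriv (by ring)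
    · exact (((hc.const_mul _).fun_mul hs).mul_const _).congr_deriv (by ring)

/-- The Gram determinant of the surface at `t = 0`, divided by `cos² φ`. -/
def regularity (a β : Fin 3 → ℝ) (C θ φ : ℝ) : ℝ :=
  C - 2 * radComp β θ φ - (azComp a θ ^ 2 + polComp a θ φ ^ 2)

lemma kinMetric_zero (a β : Fin 3 → ℝ) (C s c θ φ : ℝ) :
    kinMetric a β C s c ![0, θ, φ] = symmMatrix
      (regularity a β C θ φ + azComp a θ ^ 2 + polComp a θ φ ^ 2)
      (Real.cos φ * polComp a θ φ) (-azComp a θ) (Real.cos φ ^ 2) 0 1 := by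
  simp only [kinMetric, regularity, Matrix.cons_val_zero, Matrix.cons_val_one, Matrix.cons_val]
  congr 1 <;> ring

lemma det_kinMetric_zero (a β : Fin 3 → ℝ) (C s c θ φ : ℝ) :
    (kinMetric a β C s c ![0, θ, φ]).det = Real.cos φ ^ 2 * regularity a β C θ φ := by
  rw [kinMetric_zero, symmMatrix, Matrix.det_fin_three]
  simp
  ring

lemma inv_kinMetric_zero (a β : Fin 3 → ℝ) (C s c : ℝ) {θ φ : ℝ} (hk : Real.cos φ ≠ 0)
    (hE : regularity a β C θ φ ≠ 0) :
    (kinMetric a β C s c ![0, θ, φ])⁻¹ = frameInv (Real.cos φ) (azComp a θ) (polComp a θ φ)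
      (regularity a β C θ φ) := by
  refine Matrix.inv_eq_right_inv ?_
  rw [kinMetric_zero]
  generalize regularity a β C θ φ = E at *
  generalize Real.cos φ = k at *
  ext i j
  match i, j with
  | 0, 0 | 0, 1 | 0, 2 | 1, 0 | 1, 1 | 1, 2 | 2, 0 | 2, 1 | 2, 2 =>
    simp [frameInv, Matrix.mul_apply, Fin.sum_univ_three]
    try field_simp
    try ring

/-- The scalar curvature of `kinMetric` at `t = 0`. -/
theorem scalarCurvature_kinMetric_zero (a β : Fin 3 → ℝ) (C s c : ℝ) {θ φ : ℝ}
    (hk : Real.cos φ ≠ 0) (hE : regularity a β C θ φ ≠ 0) :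
    scalarCurvature (kinMetric a β C s c) ![0, θ, φ] * regularity a β C θ φ ^ 2
      = 2 * regularity a β C θ φ ^ 2 + regularity a β C θ φ * (-2 * s ^ 2 - 4 * c
        - 2 * (azComp a θ ^ 2 + polComp a θ φ ^ 2) + 4 * radComp a θ φ ^ 2)
      + 8 * s * (polComp a θ φ * azComp β θ - azComp a θ * polComp β θ φ)
      + 4 * s ^ 2 * (azComp a θ ^ 2 + polComp a θ φ ^ 2)
      + 2 * ((radComp a θ φ * azComp a θ - azComp β θ) ^ 2
        + (radComp a θ φ * polComp a θ φ - polComp β θ φ) ^ 2) := by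
  have hdet : (kinMetric a β C s c ![0, θ, φ]).det ≠ 0 := by
    rw [det_kinMetric_zero]
    exact mul_ne_zero (pow_ne_zero 2 hk) hE
  rw [scalarCurvature_eq_jet (hasDerivAt_kinMetric a β C s c)
    (hasDerivAt_kinMetricD a β s c θ φ) hdet, inv_kinMetric_zero a β C s c hk hE]
  have hD : (fun p => kinMetricD a β s c p ![0, θ, φ]) = frameD (Real.cos φ) (Real.sin φ)
      (radComp a θ φ) (azComp a θ) (polComp a θ φ) (azComp β θ) (polComp β θ φ) s :=
    funext fun p => kinMetricD_zero a β s c θ φ p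
  rw [hD]
  exact jetScalarCurvature_frame hk hE (by linarith [Real.sin_sq_add_cos_sq φ])

end

/-! ### Algebraic consequences of constant curvature along the sphere -/

/-- Two analytic functions on the plane whose product vanishes on a nonempty open set: one of them
vanishes identically. -/
lemma AnalyticOnNhd.eq_zero_or_eq_zero_of_mul_eqOn {E : Type*} [NormedAddCommGroup E]
    [NormedSpace ℝ E] {u v : E → ℝ} (hu : AnalyticOnNhd ℝ u Set.univ)
    (hv : AnalyticOnNhd ℝ v Set.univ) {U : Set E} (hU : IsOpen U) (hne : U.Nonempty)
    (h : ∀ p ∈ U, u p * v p = 0) : (∀ p, u p = 0) ∨ ∀ p, v p = 0 := by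
  obtain ⟨p₀, hp₀⟩ := hne
  have key : ∀ {w : E → ℝ}, AnalyticOnNhd ℝ w Set.univ → ∀ p₁, w =ᶠ[nhds p₁] 0 →
      ∀ p, w p = 0 := fun hw p₁ h₁ p =>
    hw.eqOn_zero_of_preconnected_of_eventuallyEq_zero isPreconnected_univ (Set.mem_univ p₁) h₁
      (Set.mem_univ p)
  by_cases h0 : ∃ p ∈ U, u p ≠ 0
  · obtain ⟨p, hp, hup⟩ := h0
    right
    refine key hv p ?_
    have hcont : ContinuousAt u p := (hu p (Set.mem_univ p)).continuousAt
    filter_upwards [hcont.eventually_ne hup, hU.mem_nhds hp] with y hy hyU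
    exact (mul_eq_zero.1 (h y hyU)).resolve_left hy
  · push Not at h0
    left
    refine key hu p₀ ?_
    filter_upwards [hU.mem_nhds hp₀] with y hy using h0 y hy

noncomputable section

/-- Spherical coordinates on Euclidean 3-space. -/
lemma exists_spherical_coordinates (x : Fin 3 → ℝ) :
    ∃ r θ φ : ℝ, r ^ 2 = x ⬝ᵥ x ∧ ∀ v, radComp v θ φ * r = v ⬝ᵥ x := by
  -- The longitude is the argument of the horizontal projection ζ, the latitude that of the point
  -- (|ζ|, x₂). Where an argument is only conventional, the corresponding norm is 0.
  let ζ : ℂ := ⟨x 0, x 1⟩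
  let ξ : ℂ := ⟨‖ζ‖, x 2⟩
  have h0 : ‖ζ‖ * Real.cos ζ.arg = x 0 := Complex.norm_mul_cos_arg ζ
  have h1 : ‖ζ‖ * Real.sin ζ.arg = x 1 := Complex.norm_mul_sin_arg ζ
  have h2 : ‖ξ‖ * Real.cos ξ.arg = ‖ζ‖ := Complex.norm_mul_cos_arg ξ
  have h3 : ‖ξ‖ * Real.sin ξ.arg = x 2 := Complex.norm_mul_sin_arg ξ
  refine ⟨‖ξ‖, ζ.arg, ξ.arg, ?_, fun v => ?_⟩
  · simp only [dotProduct, Fin.sum_univ_three]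
    rw [← h0, ← h1, ← h3]
    linear_combination (-‖ζ‖ ^ 2) * Real.sin_sq_add_cos_sq ζ.arg
      - ‖ξ‖ ^ 2 * Real.sin_sq_add_cos_sq ξ.arg + (‖ξ‖ * Real.cos ξ.arg + ‖ζ‖) * h2
  · simp only [radComp, dotProduct, Fin.sum_univ_three]
    rw [← h0, ← h1, ← h3, ← h2]
    ring

lemma dotProduct_frame (v w : Fin 3 → ℝ) (θ φ : ℝ) :
    radComp v θ φ * radComp w θ φ + azComp v θ * azComp w θ + polComp v θ φ * polComp w θ φ
      = v ⬝ᵥ w := by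
  have h1 : Real.sin θ ^ 2 = 1 - Real.cos θ ^ 2 := Real.sin_sq θ
  have h2 : Real.sin φ ^ 2 = 1 - Real.cos φ ^ 2 := Real.sin_sq φ
  simp only [radComp, azComp, polComp, dotProduct, Fin.sum_univ_three]
  ring_nf
  simp only [h1, h2]
  ring

/-- The parameters (θ + π, -φ) describe the antipodal point. There the radial and azimuthal vectors
are reversed while the polar one is unchanged; this parity separates odd from even terms below. -/
lemma radComp_antipode (v : Fin 3 → ℝ) (θ φ : ℝ) :
    radComp v (θ + Real.pi) (-φ) = -radComp v θ φ := by
  simp [radComp]; ring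

lemma azComp_antipode (v : Fin 3 → ℝ) (θ : ℝ) : azComp v (θ + Real.pi) = -azComp v θ := by
  simp [azComp]; ring

lemma polComp_antipode (v : Fin 3 → ℝ) (θ φ : ℝ) :
    polComp v (θ + Real.pi) (-φ) = polComp v θ φ := by
  simp [polComp]

/-- The numerator of `R - 3 / 2` at `t = 0`, where `R` is the scalar curvature of `kinMetric`. -/
def curvatureNumerator (a β : Fin 3 → ℝ) (C s c θ φ : ℝ) : ℝ :=
  1 / 2 * regularity a β C θ φ ^ 2 + regularity a β C θ φ * (-2 * s ^ 2 - 4 * c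
    - 2 * (azComp a θ ^ 2 + polComp a θ φ ^ 2) + 4 * radComp a θ φ ^ 2)
  + 8 * s * (polComp a θ φ * azComp β θ - azComp a θ * polComp β θ φ)
  + 4 * s ^ 2 * (azComp a θ ^ 2 + polComp a θ φ ^ 2)
  + 2 * ((radComp a θ φ * azComp a θ - azComp β θ) ^ 2
    + (radComp a θ φ * polComp a θ φ - polComp β θ φ) ^ 2)

/-- A biquadratic form in `a ⬝ᵥ x` and `|x|` that vanishes identically is zero unless `a = 0`. -/
lemma eq_zero_of_biquadratic {a : Fin 3 → ℝ} {k₂ k₁ k₀ : ℝ}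
    (h : ∀ x : Fin 3 → ℝ, k₂ * (a ⬝ᵥ x) ^ 4 + k₁ * (a ⬝ᵥ x) ^ 2 * (x ⬝ᵥ x)
      + k₀ * (x ⬝ᵥ x) ^ 2 = 0) (ha : a ≠ 0) : k₂ = 0 ∧ k₁ = 0 ∧ k₀ = 0 := by
  have hA : 0 < a ⬝ᵥ a := by
    refine lt_of_le_of_ne ?_ (fun h => ha (dotProduct_self_eq_zero.1 h.symm))
    simp only [dotProduct, Fin.sum_univ_three]
    nlinarith [sq_nonneg (a 0), sq_nonneg (a 1), sq_nonneg (a 2)]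
  have horth : ∃ e : Fin 3 → ℝ, a ⬝ᵥ e = 0 ∧ e ⬝ᵥ e ≠ 0 := by
    by_contra! hcon
    -- Both vectors are orthogonal to a, with squared lengths a₀² + a₁² and a₁² + a₂²; if both
    -- vanished, a would be 0.
    have h1 := hcon ![-a 1, a 0, 0] (by simp [dotProduct, Fin.sum_univ_three]; ring)
    have h2 := hcon ![0, -a 2, a 1] (by simp [dotProduct, Fin.sum_univ_three]; ring)
    simp only [dotProduct, Fin.sum_univ_three, Matrix.cons_val_zero, Matrix.cons_val_one,
      Matrix.cons_val] at h1 h2 hA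
    nlinarith [sq_nonneg (a 0), sq_nonneg (a 1), sq_nonneg (a 2)]
  obtain ⟨e, hae, hee⟩ := horth
  set A := a ⬝ᵥ a with hAdef
  -- The vector e isolates k₀; then a + e compared with a isolates k₁, and a alone gives k₂.
  have h0 := h e
  have h1 := h a
  have h2 := h (a + e)
  have hea : e ⬝ᵥ a = 0 := by rw [dotProduct_comm]; exact hae
  simp only [dotProduct_add, add_dotProduct, hae, hea, add_zero, zero_add, ← hAdef] at h0 h1 h2
  have hk₀ : k₀ = 0 := by
    have : k₀ * (e ⬝ᵥ e) ^ 2 = 0 := by linear_combination h0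
    exact (mul_eq_zero.1 this).resolve_right (pow_ne_zero 2 hee)
  subst hk₀
  have hk₁ : k₁ = 0 := by
    have : k₁ * (A ^ 2 * (e ⬝ᵥ e)) = 0 := by linear_combination h2 - h1
    exact (mul_eq_zero.1 this).resolve_right (mul_ne_zero (pow_ne_zero 2 hA.ne') hee)
  subst hk₁
  refine ⟨?_, rfl, rfl⟩
  have : k₂ * A ^ 4 = 0 := by linear_combination h1
  exact (mul_eq_zero.1 this).resolve_right (pow_ne_zero 4 hA.ne')

/-- A quadratic polynomial in `(a ⬝ᵥ x)²` vanishing on the unit sphere is zero unless `a = 0`. -/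
lemma eq_zero_of_radComp {a : Fin 3 → ℝ} {k₂ k₁ k₀ : ℝ}
    (h : ∀ θ φ, k₂ * radComp a θ φ ^ 4 + k₁ * radComp a θ φ ^ 2 + k₀ = 0) (ha : a ≠ 0) :
    k₂ = 0 ∧ k₁ = 0 ∧ k₀ = 0 := by
  refine eq_zero_of_biquadratic (fun x => ?_) ha
  obtain ⟨r, θ, φ, hr, hv⟩ := exists_spherical_coordinates x
  rw [← hv, ← hr]
  -- The biquadratic form is homogeneous of degree 4, so its values on the unit sphere determine it.
  linear_combination r ^ 4 * h θ φ

lemma eq_zero_of_radComp_eq_zero {v : Fin 3 → ℝ} (h : ∀ θ φ, radComp v θ φ = 0) : v = 0 := by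
  obtain ⟨r, θ, φ, -, hv⟩ := exists_spherical_coordinates v
  refine dotProduct_self_eq_zero.1 ?_
  rw [← hv, h, zero_mul]

lemma regularity_zero_left (β : Fin 3 → ℝ) (C θ φ : ℝ) :
    regularity 0 β C θ φ = C - 2 * radComp β θ φ := by
  simp [regularity, azComp, polComp]

/-- The antipodal average of E is C - |a|² + (a·x)², whose coefficient 1 of (a·x)² rules out a ≠ 0.
What remains, C - 2 β·x, can vanish on the sphere only if β and C do. -/
lemma eq_zero_of_regularity_eq_zero {a β : Fin 3 → ℝ} {C : ℝ}
    (h : ∀ θ φ, regularity a β C θ φ = 0) : a = 0 ∧ β = 0 ∧ C = 0 := by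
  have ha : a = 0 := by
    by_contra ha
    have := (eq_zero_of_radComp (a := a) (k₂ := 0) (k₁ := 1) (k₀ := C - a ⬝ᵥ a)
      (fun θ φ => ?_) ha).2.1
    · exact one_ne_zero this
    · have h1 := h θ φ
      have h2 := h (θ + Real.pi) (-φ)
      simp only [regularity, radComp_antipode, azComp_antipode, polComp_antipode] at h1 h2
      linear_combination (h1 + h2) / 2 + dotProduct_frame a a θ φ
  subst ha
  simp only [regularity_zero_left] at h
  have hβ : β = 0 := eq_zero_of_radComp_eq_zero fun θ φ => by
    have h2 := h (θ + Real.pi) (-φ)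
    rw [radComp_antipode] at h2
    linear_combination (h2 - h θ φ) / 4
  subst hβ
  refine ⟨rfl, rfl, ?_⟩
  have := h 0 0
  simpa [radComp] using this

/-- The antipodal average removes the mixed terms in a and β, and |a_tan|² = |a|² - (a·x)² turns the
rest into a polynomial in (a·x)². Its quartic coefficient is 1/2 from E²/2, 6 from the term linear
in E, and -2 from 2 (a·x)²|a_tan|²; the sum 9/2 is nonzero. -/
lemma eq_zero_of_curvatureNumerator_eq_zero {a β : Fin 3 → ℝ} {C s c : ℝ}
    (h : ∀ θ φ, curvatureNumerator a β C s c θ φ = 0) : a = 0 := by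
  by_contra ha
  have := (eq_zero_of_radComp (a := a) (k₂ := 9 / 2)
    (k₁ := (C - a ⬝ᵥ a) + 6 * (C - a ⬝ᵥ a) + (-2 * s ^ 2 - 4 * c - 2 * (a ⬝ᵥ a)) - 4 * s ^ 2
      + 2 * (a ⬝ᵥ a))
    (k₀ := 1 / 2 * (C - a ⬝ᵥ a) ^ 2 + (C - a ⬝ᵥ a) * (-2 * s ^ 2 - 4 * c - 2 * (a ⬝ᵥ a))
      + 4 * s ^ 2 * (a ⬝ᵥ a) + 2 * (β ⬝ᵥ β))
    (fun θ φ => ?_) ha).1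
  · norm_num at this
  · have h1 := h θ φ
    have h2 := h (θ + Real.pi) (-φ)
    simp only [curvatureNumerator, regularity, radComp_antipode, azComp_antipode,
      polComp_antipode] at h1 h2
    rw [← dotProduct_frame a a θ φ, ← dotProduct_frame β β θ φ]
    linear_combination (h1 + h2) / 2

/-- The algebraic consequences of constant scalar curvature `3 / 2` along the sphere. -/
theorem curvature_systems {a β : Fin 3 → ℝ} {C s c : ℝ}
    (h : (∀ θ φ, regularity a β C θ φ = 0) ∨ ∀ θ φ, curvatureNumerator a β C s c θ φ = 0) :
    a = 0 ∧ ((C = 2 * s ^ 2 + 4 * c ∧ C ^ 2 = 4 * (β ⬝ᵥ β))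
      ∨ (β = 0 ∧ (C = 0 ∨ C = 4 * s ^ 2 + 8 * c))) := by
  rcases h with h | h
  · obtain ⟨h1, h2, h3⟩ := eq_zero_of_regularity_eq_zero h
    exact ⟨h1, Or.inr ⟨h2, Or.inl h3⟩⟩
  · obtain rfl := eq_zero_of_curvatureNumerator_eq_zero h
    refine ⟨rfl, ?_⟩
    -- With a = 0, the square (β·x)² from E²/2 joins the tangential part of β to form 2|β|², so only
    -- an affine function of β·x is left.
    have heq : ∀ θ φ, 1 / 2 * C ^ 2 - C * (2 * s ^ 2 + 4 * c) + 2 * (β ⬝ᵥ β)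
        + radComp β θ φ * (-2 * C + 4 * s ^ 2 + 8 * c) = 0 := by
      intro θ φ
      have h1 := h θ φ
      simp only [curvatureNumerator, regularity_zero_left] at h1
      simp only [radComp, azComp, polComp, Pi.zero_apply] at h1
      have h2 := dotProduct_frame β β θ φ
      simp only [radComp, azComp, polComp] at h2 ⊢
      linear_combination h1 - 2 * h2
    have hodd : ∀ θ φ, radComp β θ φ * (-2 * C + 4 * s ^ 2 + 8 * c) = 0 := by
      intro θ φ
      have h2 := heq (θ + Real.pi) (-φ)
      rw [radComp_antipode] at h2
      linear_combination (heq θ φ - h2) / 2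
    have heven : 1 / 2 * C ^ 2 - C * (2 * s ^ 2 + 4 * c) + 2 * (β ⬝ᵥ β) = 0 := by
      linear_combination heq 0 0 - hodd 0 0
    by_cases hC : -2 * C + 4 * s ^ 2 + 8 * c = 0
    · left
      have hC' : C = 2 * s ^ 2 + 4 * c := by linarith
      refine ⟨hC', ?_⟩
      rw [← hC'] at heven
      linear_combination -2 * heven
    · right
      obtain rfl : β = 0 :=
        eq_zero_of_radComp_eq_zero fun θ φ => (mul_eq_zero.1 (hodd θ φ)).resolve_right hC
      refine ⟨rfl, ?_⟩
      rw [dotProduct_zero] at heven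
      have h3 : C * (C - (4 * s ^ 2 + 8 * c)) = 0 := by linear_combination 2 * heven
      rcases mul_eq_zero.1 h3 with h4 | h4
      · exact Or.inl h4
      · exact Or.inr (sub_eq_zero.1 h4)

/-- If the scalar curvature is `3 / 2` at all regular points of the upper hemisphere at `t = 0`,
then the surface is nowhere regular there or the curvature equation holds on the whole sphere. -/
lemma regularity_or_curvatureNumerator_eq_zero {a β : Fin 3 → ℝ} {C s c : ℝ}
    (h : ∀ θ ∈ Set.Icc (0 : ℝ) (2 * Real.pi), ∀ φ ∈ Set.Icc (0 : ℝ) Real.pi,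
      (kinMetric a β C s c ![0, θ, φ]).det ≠ 0 →
      scalarCurvature (kinMetric a β C s c) ![0, θ, φ] = 3 / 2) :
    (∀ θ φ, regularity a β C θ φ = 0) ∨ ∀ θ φ, curvatureNumerator a β C s c θ φ = 0 := by
  have hcos : AnalyticOnNhd ℝ (fun p : ℝ × ℝ => Real.cos p.2) Set.univ :=
    contDiff_omega_iff_analyticOnNhd.1 (by fun_prop)
  have hE : AnalyticOnNhd ℝ (fun p : ℝ × ℝ => regularity a β C p.1 p.2) Set.univ := by
    refine contDiff_omega_iff_analyticOnNhd.1 ?_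
    simp only [regularity, radComp, azComp, polComp]
    fun_prop
  have hQ : AnalyticOnNhd ℝ (fun p : ℝ × ℝ => curvatureNumerator a β C s c p.1 p.2)
      Set.univ := by
    refine contDiff_omega_iff_analyticOnNhd.1 ?_
    simp only [curvatureNumerator, regularity, radComp, azComp, polComp]
    fun_prop
  have hpi := Real.pi_pos
  -- The factors cos φ and E absorb the singular points of the parametrization, so the product with
  -- Q vanishes on the whole open box.
  have h1 := (hcos.mul hE).eq_zero_or_eq_zero_of_mul_eqOn hQ
    ((isOpen_Ioo (a := (0 : ℝ)) (b := 2 * Real.pi)).prod (isOpen_Ioo (a := (0 : ℝ)) (b := Real.pi)))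
    ((Set.nonempty_Ioo.2 (by positivity)).prod (Set.nonempty_Ioo.2 hpi)) (by
      rintro ⟨θ, φ⟩ ⟨hθ, hφ⟩
      by_cases hk : Real.cos φ = 0
      · simp [hk]
      by_cases hreg : regularity a β C θ φ = 0
      · simp [hreg]
      have hR := h θ (Set.Ioo_subset_Icc_self hθ) φ (Set.Ioo_subset_Icc_self hφ) (by
        rw [det_kinMetric_zero]
        exact mul_ne_zero (pow_ne_zero 2 hk) hreg)
      have hS := scalarCurvature_kinMetric_zero a β C s c hk hreg
      rw [hR] at hS
      have : curvatureNumerator a β C s c θ φ = 0 := by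
        simp only [curvatureNumerator]
        linear_combination -hS
      simp [this])
  rcases h1 with h1 | h1
  · left
    rcases hcos.eq_zero_or_eq_zero_of_mul_eqOn hE isOpen_univ Set.univ_nonempty
      (fun p _ => h1 p) with h2 | h2
    · have := h2 (0, 0)
      simp at this
    · exact fun θ φ => h2 (θ, φ)
  · exact Or.inr fun θ φ => h1 (θ, φ)

end

/-! ### The kinematic surface and its induced metric -/

noncomputable section

/-- The inclusion of the coordinate 3-space `[x₁ x₂ x₃]` into Euclidean 7-space. -/
def embedThree (y : Fin 3 → ℝ) : Fin 7 → ℝ := ![y 0, y 1, y 2, 0, 0, 0, 0]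

/-- The radial unit vector of spherical coordinates. -/
def radVec (θ φ : ℝ) : Fin 3 → ℝ :=
  ![Real.cos θ * Real.cos φ, Real.sin θ * Real.cos φ, Real.sin φ]

/-- The azimuthal unit vector of spherical coordinates. -/
def azVec (θ : ℝ) : Fin 3 → ℝ := ![-Real.sin θ, Real.cos θ, 0]

/-- The polar unit vector of spherical coordinates. -/
def polVec (θ φ : ℝ) : Fin 3 → ℝ :=
  ![-Real.cos θ * Real.sin φ, -Real.sin θ * Real.sin φ, Real.cos φ]

lemma unitSpherePoint_eq (θ φ : ℝ) : unitSpherePoint θ φ = embedThree (radVec θ φ) := rfl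

lemma dotProduct_radVec (v : Fin 3 → ℝ) (θ φ : ℝ) : v ⬝ᵥ radVec θ φ = radComp v θ φ := by
  simp [dotProduct, radVec, radComp, Fin.sum_univ_three]

lemma dotProduct_azVec (v : Fin 3 → ℝ) (θ : ℝ) : v ⬝ᵥ azVec θ = azComp v θ := by
  simp [dotProduct, azVec, azComp, Fin.sum_univ_three]; ring

lemma dotProduct_polVec (v : Fin 3 → ℝ) (θ φ : ℝ) : v ⬝ᵥ polVec θ φ = polComp v θ φ := by
  simp [dotProduct, polVec, polComp, Fin.sum_univ_three]; ring

lemma radVec_dotProduct_radVec (θ φ : ℝ) : radVec θ φ ⬝ᵥ radVec θ φ = 1 := by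
  simp only [dotProduct, radVec, Fin.sum_univ_three, Matrix.cons_val_zero, Matrix.cons_val_one,
    Matrix.cons_val]
  linear_combination Real.cos φ ^ 2 * Real.sin_sq_add_cos_sq θ + Real.sin_sq_add_cos_sq φ

lemma azVec_dotProduct_azVec (θ : ℝ) : azVec θ ⬝ᵥ azVec θ = 1 := by
  simp only [dotProduct, azVec, Fin.sum_univ_three, Matrix.cons_val_zero, Matrix.cons_val_one,
    Matrix.cons_val]
  linear_combination Real.sin_sq_add_cos_sq θ

lemma polVec_dotProduct_polVec (θ φ : ℝ) : polVec θ φ ⬝ᵥ polVec θ φ = 1 := by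
  simp only [dotProduct, polVec, Fin.sum_univ_three, Matrix.cons_val_zero, Matrix.cons_val_one,
    Matrix.cons_val]
  linear_combination Real.sin φ ^ 2 * Real.sin_sq_add_cos_sq θ + Real.sin_sq_add_cos_sq φ

lemma radVec_dotProduct_azVec (θ φ : ℝ) : radVec θ φ ⬝ᵥ azVec θ = 0 := by
  simp [dotProduct, radVec, azVec, Fin.sum_univ_three]; ring

lemma radVec_dotProduct_polVec (θ φ : ℝ) : radVec θ φ ⬝ᵥ polVec θ φ = 0 := by
  simp only [dotProduct, radVec, polVec, Fin.sum_univ_three, Matrix.cons_val_zero,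
    Matrix.cons_val_one, Matrix.cons_val]
  linear_combination (-Real.sin φ * Real.cos φ) * Real.sin_sq_add_cos_sq θ

lemma azVec_dotProduct_polVec (θ φ : ℝ) : azVec θ ⬝ᵥ polVec θ φ = 0 := by
  simp [dotProduct, polVec, azVec, Fin.sum_univ_three]; ring

lemma embedThree_dotProduct (y z : Fin 3 → ℝ) : embedThree y ⬝ᵥ embedThree z = y ⬝ᵥ z := by
  simp [embedThree, dotProduct, Fin.sum_univ_succ]

lemma dotProduct_mulVec_of_skew {n : Type*} [Fintype n] {Ω : Matrix n n ℝ}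
    (h : Ω.transpose = -Ω) (y z : n → ℝ) : y ⬝ᵥ Ω.mulVec z = -(Ω.mulVec y ⬝ᵥ z) := by
  rw [Matrix.dotProduct_mulVec, ← Matrix.mulVec_transpose, h, Matrix.neg_mulVec, neg_dotProduct]

lemma dotProduct_mulVec_self_of_skew {n : Type*} [Fintype n] {Ω : Matrix n n ℝ}
    (h : Ω.transpose = -Ω) (y : n → ℝ) : y ⬝ᵥ Ω.mulVec y = 0 := by
  have := dotProduct_mulVec_of_skew h y y
  rw [dotProduct_comm (Ω.mulVec y) y] at this
  linarith

/-- The rotation vector of the part of `Ω` acting inside the 3-space. -/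
def rotVec (Ω : Matrix (Fin 7) (Fin 7) ℝ) : Fin 3 → ℝ := ![-Ω 1 2, Ω 0 2, -Ω 0 1]

/-- The projection of `Ω d` onto the 3-space. -/
def slideVec (Ω : Matrix (Fin 7) (Fin 7) ℝ) (d : Fin 7 → ℝ) : Fin 3 → ℝ :=
  ![Ω.mulVec d 0, Ω.mulVec d 1, Ω.mulVec d 2]

/-- The right-hand side is the triple product of the rotation vector with y and z: inside the
3-space, Ω acts as the cross product with `rotVec Ω`. -/
lemma mulVec_embedThree_dotProduct {Ω : Matrix (Fin 7) (Fin 7) ℝ} (hΩ : Ω.transpose = -Ω)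
    (y z : Fin 3 → ℝ) :
    Ω.mulVec (embedThree y) ⬝ᵥ embedThree z = rotVec Ω 0 * (y 1 * z 2 - y 2 * z 1)
      + rotVec Ω 1 * (y 2 * z 0 - y 0 * z 2) + rotVec Ω 2 * (y 0 * z 1 - y 1 * z 0) := by
  have h : ∀ i j, Ω j i = -Ω i j := fun i j => congrFun (congrFun hΩ i) j
  have h00 : Ω 0 0 = 0 := by linarith [h 0 0]
  have h11 : Ω 1 1 = 0 := by linarith [h 1 1]
  have h22 : Ω 2 2 = 0 := by linarith [h 2 2]
  simp only [dotProduct, Matrix.mulVec, embedThree, rotVec, Fin.sum_univ_seven,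
    Matrix.cons_val_zero, Matrix.cons_val_one, Matrix.cons_val, mul_zero, add_zero]
  rw [h00, h11, h22, h 0 1, h 0 2, h 1 2]
  ring

lemma dotProduct_mulVec_embedThree {Ω : Matrix (Fin 7) (Fin 7) ℝ} (hΩ : Ω.transpose = -Ω)
    (d : Fin 7 → ℝ) (y : Fin 3 → ℝ) :
    d ⬝ᵥ Ω.mulVec (embedThree y) = -(slideVec Ω d ⬝ᵥ y) := by
  rw [dotProduct_mulVec_of_skew hΩ]
  simp [dotProduct, embedThree, slideVec, Fin.sum_univ_succ]

lemma mulVec_radVec_dotProduct_azVec {Ω : Matrix (Fin 7) (Fin 7) ℝ} (hΩ : Ω.transpose = -Ω)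
    (θ φ : ℝ) : Ω.mulVec (embedThree (radVec θ φ)) ⬝ᵥ embedThree (azVec θ)
      = polComp (rotVec Ω) θ φ := by
  rw [mulVec_embedThree_dotProduct hΩ]
  simp only [radVec, azVec, polComp, Matrix.cons_val_zero, Matrix.cons_val_one, Matrix.cons_val]
  linear_combination rotVec Ω 2 * Real.cos φ * Real.sin_sq_add_cos_sq θ

lemma mulVec_radVec_dotProduct_polVec {Ω : Matrix (Fin 7) (Fin 7) ℝ} (hΩ : Ω.transpose = -Ω)
    (θ φ : ℝ) : Ω.mulVec (embedThree (radVec θ φ)) ⬝ᵥ embedThree (polVec θ φ)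
      = -azComp (rotVec Ω) θ := by
  rw [mulVec_embedThree_dotProduct hΩ]
  simp only [radVec, polVec, azComp, Matrix.cons_val_zero, Matrix.cons_val_one, Matrix.cons_val]
  linear_combination (rotVec Ω 0 * Real.sin θ - rotVec Ω 1 * Real.cos θ)
    * Real.sin_sq_add_cos_sq φ

lemma hasDerivAt_embedThree {γ : ℝ → Fin 3 → ℝ} {γ' : Fin 3 → ℝ} {x : ℝ}
    (h : HasDerivAt γ γ' x) : HasDerivAt (fun t => embedThree (γ t)) (embedThree γ') x := by
  have h' := hasDerivAt_pi.1 h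
  refine hasDerivAt_pi.2 fun i => ?_
  fin_cases i
  exacts [h' 0, h' 1, h' 2, hasDerivAt_const _ _, hasDerivAt_const _ _, hasDerivAt_const _ _,
    hasDerivAt_const _ _]

lemma hasDerivAt_radVec_az (θ φ : ℝ) :
    HasDerivAt (fun h => radVec h φ) (Real.cos φ • azVec θ) θ := by
  refine hasDerivAt_pi.2 fun i => ?_
  match i with
  | 0 => exact ((Real.hasDerivAt_cos θ).mul_const _).congr_deriv (by simp [azVec]; ring)
  | 1 => exact ((Real.hasDerivAt_sin θ).mul_const _).congr_deriv (by simp [azVec]; ring)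
  | 2 => exact (hasDerivAt_const _ _).congr_deriv (by simp [azVec])

lemma hasDerivAt_radVec_pol (θ φ : ℝ) :
    HasDerivAt (fun h => radVec θ h) (polVec θ φ) φ := by
  refine hasDerivAt_pi.2 fun i => ?_
  match i with
  | 0 => exact ((Real.hasDerivAt_cos φ).const_mul _).congr_deriv (by simp [polVec])
  | 1 => exact ((Real.hasDerivAt_cos φ).const_mul _).congr_deriv (by simp [polVec])
  | 2 => exact (Real.hasDerivAt_sin φ).congr_deriv (by simp [polVec])

lemma hasDerivAt_mulVec {m n : Type*} [Fintype m] [Fintype n] (B : Matrix m n ℝ)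
    {γ : ℝ → n → ℝ} {γ' : n → ℝ} {x : ℝ} (h : HasDerivAt γ γ' x) :
    HasDerivAt (fun t => B.mulVec (γ t)) (B.mulVec γ') x := by
  refine hasDerivAt_pi.2 fun i => ?_
  exact HasDerivAt.fun_sum fun j _ => ((hasDerivAt_pi.1 h j).const_mul (B i j))

namespace EquiformMotion

variable (M : EquiformMotion)

lemma surface_eq (u : Fin 3 → ℝ) :
    M.surface u = (1 + u 0 * M.s') • embedThree (radVec (u 1) (u 2))
      + u 0 • M.Omega.mulVec (embedThree (radVec (u 1) (u 2))) + u 0 • M.d' := by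
  rw [surface, unitSpherePoint_eq, Matrix.add_mulVec, Matrix.one_mulVec, Matrix.smul_mulVec,
    Matrix.add_mulVec, Matrix.smul_mulVec, Matrix.one_mulVec]
  module

lemma partialDeriv_zero_surface (u : Fin 3 → ℝ) :
    partialDeriv 0 M.surface u = M.s' • embedThree (radVec (u 1) (u 2))
      + M.Omega.mulVec (embedThree (radVec (u 1) (u 2))) + M.d' := by
  refine HasDerivAt.deriv ?_
  simp only [surface_eq, Function.update_self, ne_eq, one_ne_zero, not_false_eq_true,
    Function.update_of_ne, Fin.reduceEq]
  have hid := hasDerivAt_id (u 0)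
  have := ((((hid.mul_const M.s').const_add 1).smul_const
    (embedThree (radVec (u 1) (u 2)))).fun_add (hid.smul_const
    (M.Omega.mulVec (embedThree (radVec (u 1) (u 2)))))).fun_add (hid.smul_const M.d')
  exact this.congr_deriv (by module)

lemma partialDeriv_one_surface (u : Fin 3 → ℝ) :
    partialDeriv 1 M.surface u = Real.cos (u 2) • ((1 + u 0 * M.s') • embedThree (azVec (u 1))
      + u 0 • M.Omega.mulVec (embedThree (azVec (u 1)))) := by
  refine HasDerivAt.deriv ?_
  simp only [surface_eq, Function.update_self, ne_eq, zero_ne_one, not_false_eq_true,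
    Function.update_of_ne, Fin.reduceEq]
  have hx := hasDerivAt_embedThree (hasDerivAt_radVec_az (u 1) (u 2))
  have := ((hx.const_smul (1 + u 0 * M.s')).fun_add
    ((hasDerivAt_mulVec M.Omega hx).const_smul (u 0))).add_const (u 0 • M.d')
  have he : embedThree (Real.cos (u 2) • azVec (u 1))
      = Real.cos (u 2) • embedThree (azVec (u 1)) := by
    simp [embedThree]
  refine this.congr_deriv ?_
  rw [he, Matrix.mulVec_smul]
  module

lemma partialDeriv_two_surface (u : Fin 3 → ℝ) :
    partialDeriv 2 M.surface u = (1 + u 0 * M.s') • embedThree (polVec (u 1) (u 2))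
      + u 0 • M.Omega.mulVec (embedThree (polVec (u 1) (u 2))) := by
  refine HasDerivAt.deriv ?_
  simp only [surface_eq, Function.update_self, ne_eq, not_false_eq_true,
    Function.update_of_ne, Fin.reduceEq]
  have hx := hasDerivAt_embedThree (hasDerivAt_radVec_pol (u 1) (u 2))
  exact ((hx.const_smul (1 + u 0 * M.s')).fun_add
    ((hasDerivAt_mulVec M.Omega hx).const_smul (u 0))).add_const (u 0 • M.d')

/-- The derivative of a curve of rotations at the identity is skew-symmetric. -/
lemma Omega_transpose : M.Omega.transpose = -M.Omega := by
  have hI : M.I ∈ nhds (0 : ℝ) := M.isOpen_I.mem_nhds M.zero_mem_I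
  have hd : ∀ i j, HasDerivAt (fun t => M.A t i j) (M.Omega i j) 0 := fun i j =>
    (((M.contDiffOn_A i j).contDiffAt hI).differentiableAt one_ne_zero).hasDerivAt
  ext i j
  have h1 : HasDerivAt (fun t => ∑ k, M.A t k i * M.A t k j)
      (∑ k, (M.Omega k i * M.A 0 k j + M.A 0 k i * M.Omega k j)) 0 :=
    HasDerivAt.fun_sum fun k _ => (hd k i).fun_mul (hd k j)
  have h2 : (fun t => ∑ k, M.A t k i * M.A t k j)
      =ᶠ[nhds 0] fun _ => (1 : Matrix (Fin 7) (Fin 7) ℝ) i j := by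
    filter_upwards [hI] with t ht
    have h3 := (Matrix.mem_orthogonalGroup_iff' (Fin 7) ℝ).1
      (Matrix.mem_specialOrthogonalGroup_iff.1 (M.A_mem t ht)).1
    rw [← h3]
    simp [Matrix.mul_apply]
  have h4 := h1.unique ((hasDerivAt_const (0 : ℝ) _).congr_of_eventuallyEq h2)
  rw [M.A_zero] at h4
  simp only [Finset.sum_add_distrib, Matrix.one_apply, mul_ite, mul_one, mul_zero, ite_mul,
    one_mul, zero_mul, Finset.sum_ite_eq', Finset.mem_univ, if_true] at h4
  simp only [Matrix.transpose_apply, Matrix.neg_apply]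
  linarith

/-- If the surface is foliated by spheres, then `Ω` restricted to the 3-space is a similarity onto
its image. -/
lemma exists_gram (h : M.FoliatedBySpheres) :
    ∃ c, ∀ y z, M.Omega.mulVec (embedThree y) ⬝ᵥ M.Omega.mulVec (embedThree z)
      = c * (y ⬝ᵥ z) := by
  have hΩ := M.Omega_transpose
  -- At t = 0 the foliation condition says nothing about Ω; one nonzero time is enough.
  obtain ⟨t, htI, ht⟩ : ∃ t ∈ M.I, t ≠ 0 := by
    have hI : M.I ∈ nhds (0 : ℝ) := M.isOpen_I.mem_nhds M.zero_mem_I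
    obtain ⟨ε, hε, hsub⟩ := Metric.mem_nhds_iff.1 hI
    refine ⟨ε / 2, hsub ?_, by positivity⟩
    rw [Metric.mem_ball, Real.dist_eq, sub_zero, abs_of_pos (by positivity)]
    linarith
  obtain ⟨r, hr⟩ := h t htI
  set q : (Fin 3 → ℝ) → (Fin 3 → ℝ) → ℝ := fun y z =>
    M.Omega.mulVec (embedThree y) ⬝ᵥ M.Omega.mulVec (embedThree z) with hq
  -- Skewness kills the cross term x · Ωx, so r² = (1 + ts')² + t²|Ωx|² can be solved for |Ωx|².
  have hc : ∀ θ φ, q (radVec θ φ) (radVec θ φ) = (r ^ 2 - (1 + t * M.s') ^ 2) / t ^ 2 := by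
    intro θ φ
    have h1 := hr θ φ
    have h2 := dotProduct_mulVec_self_of_skew hΩ (embedThree (radVec θ φ))
    have h3 := embedThree_dotProduct (radVec θ φ) (radVec θ φ)
    rw [radVec_dotProduct_radVec] at h3
    rw [surface_eq] at h1
    simp only [Matrix.cons_val_zero, Matrix.cons_val_one, Matrix.cons_val, add_sub_cancel_right,
      add_dotProduct, dotProduct_add, smul_dotProduct, dotProduct_smul, smul_eq_mul, h3,
      dotProduct_comm (M.Omega.mulVec (embedThree (radVec θ φ))) (embedThree (radVec θ φ)),
      h2] at h1
    rw [eq_div_iff (pow_ne_zero 2 ht)]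
    simp only [hq]
    linear_combination h1
  set c := (r ^ 2 - (1 + t * M.s') ^ 2) / t ^ 2
  have hsymm : ∀ y z, q y z = q z y := fun y z => dotProduct_comm _ _
  set G : Fin 3 → Fin 3 → ℝ := fun i j => q (Pi.single i 1) (Pi.single j 1) with hG
  have hexp : ∀ y z, q y z = ∑ i, ∑ j, y i * z j * G i j := by
    intro y z
    have hlin : ∀ y, M.Omega.mulVec (embedThree y)
        = ∑ i, y i • M.Omega.mulVec (embedThree (Pi.single i 1)) := by
      intro y
      simp only [← Matrix.mulVec_smul, Fin.sum_univ_three, ← Matrix.mulVec_add]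
      congr 1
      simp [embedThree]
    simp only [hG, hq]
    rw [hlin y, hlin z]
    simp only [Fin.sum_univ_three, add_dotProduct, dotProduct_add, smul_dotProduct,
      dotProduct_smul, smul_eq_mul]
    ring
  have hGs : ∀ i j, G i j = G j i := fun i j => hsymm _ _
  have hpt : ∀ θ φ, ∑ i, ∑ j, radVec θ φ i * radVec θ φ j * G i j = c := fun θ φ => by
    rw [← hexp]; exact hc θ φ
  have hs2 : (√2 / 2 : ℝ) * (√2 / 2) = 1 / 2 := by
    have := Real.mul_self_sqrt (show (0 : ℝ) ≤ 2 by norm_num)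
    linarith
  -- The three coordinate unit vectors and the three bisectors of coordinate pairs: the former give
  -- the diagonal of the Gram matrix, the latter its off-diagonal entries by polarization.
  have e1 := hpt 0 0
  have e2 := hpt (Real.pi / 2) 0
  have e3 := hpt 0 (Real.pi / 2)
  have e4 := hpt (Real.pi / 4) 0
  have e5 := hpt 0 (Real.pi / 4)
  have e6 := hpt (Real.pi / 2) (Real.pi / 4)
  simp [radVec, Fin.sum_univ_three, hs2] at e1 e2 e3 e4 e5 e6
  rw [hGs 1 0] at e4
  rw [hGs 2 0] at e5
  rw [hGs 2 1] at e6
  have g01 : G 0 1 = 0 := by linarith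
  have g02 : G 0 2 = 0 := by linarith
  have g12 : G 1 2 = 0 := by linarith
  refine ⟨c, fun y z => ?_⟩
  change q y z = _
  rw [hexp]
  simp only [Fin.sum_univ_three, dotProduct, hGs 1 0, hGs 2 0, hGs 2 1, g01, g02, g12, e1, e2, e3]
  ring

end EquiformMotion

end

noncomputable section

namespace EquiformMotion

/-- The velocity is s'x + Ωx + d'. Conformality of Ω on the 3-space and its skewness keep the
angular block diagonal. Orthogonality of d' to the 3-space leaves d' only in |d'|² and in the
products d' · Ωy = -β·y. -/
lemma metric_eq_kinMetric (M : EquiformMotion) {c : ℝ}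
    (hc : ∀ y z, M.Omega.mulVec (embedThree y) ⬝ᵥ M.Omega.mulVec (embedThree z) = c * (y ⬝ᵥ z))
    (hd : ∀ y, M.d' ⬝ᵥ embedThree y = 0) :
    M.metric = kinMetric (rotVec M.Omega) (slideVec M.Omega M.d')
      (M.s' ^ 2 + c + M.d' ⬝ᵥ M.d') M.s' c := by
  have hΩ := M.Omega_transpose
  funext u
  set x := radVec (u 1) (u 2) with hx
  set y := azVec (u 1) with hy
  set z := polVec (u 1) (u 2) with hz
  have hxx : x ⬝ᵥ x = 1 := radVec_dotProduct_radVec _ _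
  have hyy : y ⬝ᵥ y = 1 := azVec_dotProduct_azVec _
  have hzz : z ⬝ᵥ z = 1 := polVec_dotProduct_polVec _ _
  have hxy : x ⬝ᵥ y = 0 := radVec_dotProduct_azVec _ _
  have hxz : x ⬝ᵥ z = 0 := radVec_dotProduct_polVec _ _
  have hyz : y ⬝ᵥ z = 0 := azVec_dotProduct_polVec _ _
  have hsk := fun v w : Fin 3 → ℝ => dotProduct_mulVec_of_skew hΩ (embedThree v) (embedThree w)
  have hself := fun v : Fin 3 → ℝ => dotProduct_mulVec_self_of_skew hΩ (embedThree v)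
  have hself' := fun v : Fin 3 → ℝ =>
    (dotProduct_comm (M.Omega.mulVec (embedThree v)) (embedThree v)).trans (hself v)
  have hd' := fun v : Fin 3 → ℝ => (dotProduct_comm (embedThree v) M.d').trans (hd v)
  have hdΩ := fun v => dotProduct_mulVec_embedThree hΩ M.d' v
  have hΩd := fun v : Fin 3 → ℝ =>
    (dotProduct_comm (M.Omega.mulVec (embedThree v)) M.d').trans (hdΩ v)
  have hxyΩ := mulVec_radVec_dotProduct_azVec hΩ (u 1) (u 2)
  have hxzΩ := mulVec_radVec_dotProduct_polVec hΩ (u 1) (u 2)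
  rw [← hx, ← hy] at hxyΩ
  rw [← hx, ← hz] at hxzΩ
  have hβx : slideVec M.Omega M.d' ⬝ᵥ x = radComp (slideVec M.Omega M.d') (u 1) (u 2) :=
    dotProduct_radVec _ _ _
  have hβy : slideVec M.Omega M.d' ⬝ᵥ y = azComp (slideVec M.Omega M.d') (u 1) :=
    dotProduct_azVec _ _
  have hβz : slideVec M.Omega M.d' ⬝ᵥ z = polComp (slideVec M.Omega M.d') (u 1) (u 2) :=
    dotProduct_polVec _ _ _
  have h0 := M.partialDeriv_zero_surface u
  have h1 := M.partialDeriv_one_surface u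
  have h2 := M.partialDeriv_two_surface u
  rw [← hx] at h0
  rw [← hy] at h1
  rw [← hz] at h2
  have g00 : partialDeriv 0 M.surface u ⬝ᵥ partialDeriv 0 M.surface u
      = M.s' ^ 2 + c + M.d' ⬝ᵥ M.d'
        - 2 * radComp (slideVec M.Omega M.d') (u 1) (u 2) := by
    simp only [h0, add_dotProduct, dotProduct_add, smul_dotProduct, dotProduct_smul,
      smul_eq_mul, embedThree_dotProduct, hc, hd, hd', hdΩ, hΩd, hself, hself', hxx, hβx]
    ring
  have g01 : partialDeriv 0 M.surface u ⬝ᵥ partialDeriv 1 M.surface u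
      = Real.cos (u 2) * (polComp (rotVec M.Omega) (u 1) (u 2)
        - u 0 * azComp (slideVec M.Omega M.d') (u 1)) := by
    simp only [h0, h1, add_dotProduct, dotProduct_add, smul_dotProduct, dotProduct_smul,
      smul_eq_mul, embedThree_dotProduct, hc, hd, hdΩ, hsk x y, hxyΩ, hxy, hβy]
    ring
  have g02 : partialDeriv 0 M.surface u ⬝ᵥ partialDeriv 2 M.surface u
      = -azComp (rotVec M.Omega) (u 1)
        - u 0 * polComp (slideVec M.Omega M.d') (u 1) (u 2) := by
    simp only [h0, h2, add_dotProduct, dotProduct_add, smul_dotProduct, dotProduct_smul,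
      smul_eq_mul, embedThree_dotProduct, hc, hd, hdΩ, hsk x z, hxzΩ, hxz, hβz]
    ring
  have g11 : partialDeriv 1 M.surface u ⬝ᵥ partialDeriv 1 M.surface u
      = (1 + 2 * M.s' * u 0 + (M.s' ^ 2 + c) * u 0 ^ 2) * Real.cos (u 2) ^ 2 := by
    simp only [h1, add_dotProduct, dotProduct_add, smul_dotProduct, dotProduct_smul,
      smul_eq_mul, embedThree_dotProduct, hc, hself, hself', hyy]
    ring
  have g12 : partialDeriv 1 M.surface u ⬝ᵥ partialDeriv 2 M.surface u = 0 := by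
    simp only [h1, h2, add_dotProduct, dotProduct_add, smul_dotProduct, dotProduct_smul,
      smul_eq_mul, embedThree_dotProduct, hc, hsk y z, hyz]
    ring
  have g22 : partialDeriv 2 M.surface u ⬝ᵥ partialDeriv 2 M.surface u
      = 1 + 2 * M.s' * u 0 + (M.s' ^ 2 + c) * u 0 ^ 2 := by
    simp only [h2, add_dotProduct, dotProduct_add, smul_dotProduct, dotProduct_smul,
      smul_eq_mul, embedThree_dotProduct, hc, hself, hself', hzz]
    ring
  have hs := fun i j : Fin 3 =>
    dotProduct_comm (partialDeriv i M.surface u) (partialDeriv j M.surface u)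
  ext i j
  match i, j with
  | 0, 0 => exact g00
  | 0, 1 => exact g01
  | 0, 2 => exact g02
  | 1, 0 => exact (hs 1 0).trans g01
  | 1, 1 => exact g11
  | 1, 2 => exact g12
  | 2, 0 => exact (hs 2 0).trans g02
  | 2, 1 => exact (hs 2 1).trans g12
  | 2, 2 => exact g22

end EquiformMotion

end

/-! ### Translation to the entries of Ω and d' -/

theorem mainTheorem3 (M : EquiformMotion)
    (hsph : M.FoliatedBySpheres)
    (hb : M.b' 1 = 0 ∧ M.b' 2 = 0 ∧ M.b' 3 = 0)
    (hK : ∀ θ ∈ Set.Icc (0 : ℝ) (2 * Real.pi), ∀ φ ∈ Set.Icc (0 : ℝ) Real.pi,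
      M.RegularAt 0 θ φ → M.K 0 θ φ = -(3 / 2)) :
    (M.ω 1 = 0 ∧ M.ω 2 = 0 ∧ M.ω 7 = 0) ∧
    ((M.s' ^ 2 + 3 * ∑ i ∈ Finset.Icc 3 6, M.ω i ^ 2 = ∑ i ∈ Finset.Icc 4 7, M.b' i ^ 2 ∧
      4 * (M.s' ^ 2 + 2 * ∑ i ∈ Finset.Icc 4 7, M.b' i ^ 2) ^ 2 =
        9 * (4 * (∑ i ∈ Finset.Icc 4 7, M.b' i * M.ω (i + 8)) ^ 2
          + 4 * (∑ i ∈ Finset.Icc 4 7, M.b' i * M.ω (i - 1)) ^ 2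
          + 4 * (∑ i ∈ Finset.Icc 4 7, M.b' i * M.ω (i + 4)) ^ 2)) ∨
     ((∑ i ∈ Finset.Icc 4 7, M.b' i * M.ω (i - 1) = 0 ∧
       ∑ i ∈ Finset.Icc 4 7, M.b' i * M.ω (i + 4) = 0 ∧
       ∑ i ∈ Finset.Icc 4 7, M.b' i * M.ω (i + 8) = 0) ∧
      3 * M.s' ^ 2 + 7 * ∑ i ∈ Finset.Icc 3 6, M.ω i ^ 2 = ∑ i ∈ Finset.Icc 4 7, M.b' i ^ 2)) := by
  obtain ⟨hb1, hb2, hb3⟩ := hb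
  have hd0 : M.d' 0 = 0 := hb1
  have hd1 : M.d' 1 = 0 := hb2
  have hd2 : M.d' 2 = 0 := hb3
  have hΩ := M.Omega_transpose
  have hskew : ∀ i j, M.Omega j i = -M.Omega i j := fun i j => congrFun (congrFun hΩ i) j
  have hdiag : M.Omega 0 0 = 0 := by linarith [hskew 0 0]
  obtain ⟨c, hc⟩ := M.exists_gram hsph
  have hd : ∀ y, M.d' ⬝ᵥ embedThree y = 0 := fun y => by
    simp [dotProduct, embedThree, Fin.sum_univ_seven, hd0, hd1, hd2]
  have hmetric := M.metric_eq_kinMetric hc hd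
  obtain ⟨ha, hsys⟩ := curvature_systems (regularity_or_curvatureNumerator_eq_zero
    (fun θ hθ φ hφ hdet => by
      have := hK θ hθ φ hφ (by rw [EquiformMotion.RegularAt, hmetric]; exact hdet)
      rw [EquiformMotion.K, hmetric] at this
      linarith))
  have h12 : M.Omega 1 2 = 0 := neg_eq_zero.1 (congrFun ha 0)
  have h02 : M.Omega 0 2 = 0 := congrFun ha 1
  have h01 : M.Omega 0 1 = 0 := neg_eq_zero.1 (congrFun ha 2)
  -- The factor c is the squared length of the first column of Ω, whose entries inside the 3-space
  -- vanish because a = 0.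
  have hcs : c = ∑ i ∈ Finset.Icc 3 6, M.ω i ^ 2 := by
    have h := hc ![1, 0, 0] ![1, 0, 0]
    simp only [dotProduct, Matrix.mulVec, embedThree, Fin.sum_univ_seven, Fin.sum_univ_three,
      Matrix.cons_val_zero, Matrix.cons_val_one, Matrix.cons_val, mul_zero, add_zero,
      mul_one] at h
    rw [hdiag, hskew 0 1, hskew 0 2, hskew 0 3, hskew 0 4, hskew 0 5, hskew 0 6, h01, h02] at h
    simp only [show Finset.Icc 3 6 = {3, 4, 5, 6} from rfl, EquiformMotion.ω]
    simp
    linarith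
  have hD : M.d' ⬝ᵥ M.d' = ∑ i ∈ Finset.Icc 4 7, M.b' i ^ 2 := by
    simp [show Finset.Icc 4 7 = {4, 5, 6, 7} from rfl, EquiformMotion.b', dotProduct,
      Fin.sum_univ_seven, hd0, hd1, hd2]
    ring
  have hβ0 : slideVec M.Omega M.d' 0 = ∑ i ∈ Finset.Icc 4 7, M.b' i * M.ω (i - 1) := by
    simp [show Finset.Icc 4 7 = {4, 5, 6, 7} from rfl, EquiformMotion.b', EquiformMotion.ω,
      slideVec, Matrix.mulVec, dotProduct, Fin.sum_univ_seven, hd0, hd1, hd2]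
    ring
  have hβ1 : slideVec M.Omega M.d' 1 = ∑ i ∈ Finset.Icc 4 7, M.b' i * M.ω (i + 4) := by
    simp [show Finset.Icc 4 7 = {4, 5, 6, 7} from rfl, EquiformMotion.b', EquiformMotion.ω,
      slideVec, Matrix.mulVec, dotProduct, Fin.sum_univ_seven, hd0, hd1, hd2]
    ring
  have hβ2 : slideVec M.Omega M.d' 2 = ∑ i ∈ Finset.Icc 4 7, M.b' i * M.ω (i + 8) := by
    simp [show Finset.Icc 4 7 = {4, 5, 6, 7} from rfl, EquiformMotion.b', EquiformMotion.ω,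
      slideVec, Matrix.mulVec, dotProduct, Fin.sum_univ_seven, hd0, hd1, hd2]
    ring
  have hc0 : 0 ≤ c := hcs ▸ Finset.sum_nonneg fun i _ => sq_nonneg _
  have hD0 : 0 ≤ M.d' ⬝ᵥ M.d' := hD ▸ Finset.sum_nonneg fun i _ => sq_nonneg _
  refine ⟨⟨h01, h02, h12⟩, ?_⟩
  rw [← hcs, ← hD, ← hβ0, ← hβ1, ← hβ2]
  rcases hsys with ⟨hC, hββ⟩ | ⟨hβ, hC⟩
  · left
    have h1 : M.s' ^ 2 + 3 * c = M.d' ⬝ᵥ M.d' := by linarith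
    refine ⟨h1, ?_⟩
    have hβs : slideVec M.Omega M.d' ⬝ᵥ slideVec M.Omega M.d' = slideVec M.Omega M.d' 0 ^ 2
        + slideVec M.Omega M.d' 1 ^ 2 + slideVec M.Omega M.d' 2 ^ 2 := by
      simp only [dotProduct, Fin.sum_univ_three]
      ring
    rw [hβs, ← h1] at hββ
    rw [← h1]
    -- With |d'|² = s'² + 3c one has s'² + 2|d'|² = 3C/2, so the second equation is 9 times C² =
    -- 4|β|².
    linear_combination 9 * hββ
  · right
    refine ⟨⟨congrFun hβ 0, congrFun hβ 1, congrFun hβ 2⟩, ?_⟩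
    rcases hC with hC | hC
    -- Here C = 0 is a sum of the nonnegative terms s'², c and |d'|², so all three vanish.
    · nlinarith [sq_nonneg M.s']
    · linarith
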